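/- **Setting.** Let $\mathcal A$ be a finite or countable alphabet with a transition relation (``$ab$ is admissible''), let $I_a\subset[0,1]$ ($a\in\mathcal A$) be non-empty open intervals, possibly overlapping, and for each admissible $ab$ let $g_{ab}:I_b\to I_a$ be a $C^1$ map such that: * (inverse branches) for each $a$ there is a map $T_a$ with $T_a(g_{ab}(x))=x$ for all admissible $ab$ and $x\in I_b$; * (uniform contraction) there is $\kappa_+\in(0,1)$ and for each admissible $ab$ some $\kappa_-(ab)\in(0,1)$ with $\kappa_-(ab)\le|g_{ab}'|\le\kappa_+$ on $I_b$; * (bounded distortion) there are $C,\alpha>0$ with $\big|\log|g_{ab}'(x)|-\log|g_{ab}'(y)|\big|\le C|x-y|^\alpha$ for all admissible $ab$ and $x,y\in I_b$. For an admissible word $\mathbf a=a_1\cdots a_n$ put $I_{\mathbf a}=g_{a_1a_2}\circ\cdots\circ g_{a_{n-1}a_n}(I_{a_n})$. Let $\Sigma^n$ be the set of admissible words of length $n$, $\Sigma^{\mathbb N}$ the space of admissible infinite words, $[b]$ the set of those beginning with $b$, $F=\bigcap_{n\ge1}\bigcup_{\mathbf a\in\Sigma^n}\overline{I_{\mathbf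 a}}$ the attractor, and $\pi:\Sigma^{\mathbb N}\to F$ the coding map, $\{\pi(\omega)\}=\bigcap_n\overline{I_{\omega_1\cdots\omega_n}}$. Let $\phi:\Sigma^{\mathbb N}\to\mathbb R$ be a potential such that: * (summable variations) $\sum_{n\ge2}\sup\{|\phi(\omega)-\phi(\eta)|:\omega_i=\eta_i\text{ for }1\le i\le n\}<\infty$; * (normalised) $\phi<0$, and $\sum_{a:\,ab\text{ admissible}}e^{\phi(a\omega)}=1$ for every $b\in\mathcal A$ and $\omega\in[b]$; * (light tail) for some $\gamma_0>0$, $$\sum_{a\in\mathcal A}\ \sup_{b:\,ab\text{ admissible}}\ \sup_{\omega\in[b],\,x\in I_b}e^{\phi(a\omega)}|g_{ab}'(x)|^{-\gamma_0}<\infty .$$ Let $\nu$ be a Gibbs measure of $\phi$, i.e. a Borel probability measure on $\Sigma^{\mathbb N}$ with $$\int f\,d\nu=\sum_{ab\text{ admissible}}\int_{[b]}e^{\phi(a\omega)}f(a\omega)\,d\nu(\omega)$$ for all bounded continuous $f$, and let $\mu=\pi_*\nu$ be the projected Gibbs measure. **Proposition (upper regularity).** Suppose that $F$ is not a single point and that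 at least one of the following holds: * the IFS has no overlaps, i.e. the intervals $I_a$, $a\in\mathcal A$, are pairwise disjoint; or * $\phi$ is locally constant with Bernoulli weights: there are $p_a>0$ with $\sum_{a\in\mathcal A}p_a=1$ and $e^{\phi(\omega)}=p_{\omega_1}$ for all $\omega\in\Sigma^{\mathbb N}$. Then there are $C_{reg}\ge1$ and $s_\mu\in(0,1)$ such that $\mu(J)\le C_{reg}|J|^{s_\mu}$ for every interval $J\subset\mathbb R$. -/

import Mathlib

open Set MeasureTheory
open scoped ENNReal

/-- A `C^{1+α}` Markov iterated function system over the alphabet `A` (finite or countable, in the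
uses below): open intervals `I_a ⊆ [0,1]`, possibly overlapping, a transition matrix `adm`, and for
each admissible pair `ab` a contraction `g_{ab} : I_b → I_a`, which is an inverse branch of an
expanding map `T_a` (the branch, living on `I_a`, of the expanding map), with uniform contraction
and bounded distortion. -/
structure MarkovIFS (A : Type*) where
  /-- Left endpoint of `I_a`. -/
  lo : A → ℝ
  /-- Right endpoint of `I_a`. -/
  hi : A → ℝ
  lo_nonneg : ∀ a, 0 ≤ lo a
  lo_lt_hi : ∀ a, lo a < hi a
  hi_le_one : ∀ a, hi a ≤ 1
  /-- `adm a b` means that the pair `ab` is admissible. -/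
  adm : A → A → Prop
  /-- The maps `g_{ab}`; only the values on `I_b` for admissible `ab` matter. -/
  g : A → A → ℝ → ℝ
  /-- The branches `T_a` that the `g_{ab}` invert; only the values on `g_{ab}(I_b)` matter. -/
  T : A → ℝ → ℝ
  mapsTo : ∀ a b, adm a b → MapsTo (g a b) (Ioo (lo b) (hi b)) (Ioo (lo a) (hi a))
  inverse_branch : ∀ a b, adm a b → ∀ x ∈ Ioo (lo b) (hi b), T a (g a b x) = x
  contDiffOn : ∀ a b, adm a b → ContDiffOn ℝ 1 (g a b) (Ioo (lo b) (hi b))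
  /-- The contraction constant `κ₊`. -/
  κ : ℝ
  κ_pos : 0 < κ
  κ_lt_one : κ < 1
  contraction : ∀ a b, adm a b → ∃ m : ℝ, 0 < m ∧ m < 1 ∧
    ∀ x ∈ Ioo (lo b) (hi b), m ≤ |deriv (g a b) x| ∧ |deriv (g a b) x| ≤ κ
  /-- The distortion constant. -/
  C : ℝ
  /-- The Hölder exponent. -/
  α : ℝ
  C_pos : 0 < C
  α_pos : 0 < α
  distortion : ∀ a b, adm a b → ∀ x ∈ Ioo (lo b) (hi b), ∀ y ∈ Ioo (lo b) (hi b),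
    |Real.log (|deriv (g a b) x|) - Real.log (|deriv (g a b) y|)| ≤ C * |x - y| ^ α

namespace MarkovIFS

variable {A : Type*} (S : MarkovIFS A)

/-- The open interval `I_a`. -/
def I (a : A) : Set ℝ := Ioo (S.lo a) (S.hi a)

/-- The set `I_w = g_w (I_{w_n})` of the word `w_0 w_1 … w_n` of length `n + 1`, that is
`g_{w_0 w_1} ∘ ⋯ ∘ g_{w_{n-1} w_n} (I_{w_n})`. The word is given as the first `n + 1` letters
of a sequence `w`; the other letters are not used. -/
def wordInterval : ℕ → (ℕ → A) → Set ℝ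
  | 0, w => S.I (w 0)
  | n + 1, w => S.g (w 0) (w 1) '' wordInterval n (fun k => w (k + 1))

/-- The attractor `F = ⋂_n ⋃_w closure I_w`, the union being over the admissible words `w` of
length `n + 1`. -/
def attractor : Set ℝ :=
  ⋂ n : ℕ, ⋃ w ∈ {w : ℕ → A | ∀ k < n, S.adm (w k) (w (k + 1))}, closure (S.wordInterval n w)

/-- The IFS has no overlaps: the intervals `I_a` are pairwise disjoint. -/
def NoOverlaps : Prop := Pairwise fun a b : A => Disjoint (S.I a) (S.I b)

/-- The symbolic space of admissible infinite words (a subspace of the product `ℕ → A`). -/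
abbrev Shift : Type _ := {ω : ℕ → A // ∀ n, S.adm (ω n) (ω (n + 1))}

/-- The word `aω`. -/
def cons (a : A) (ω : S.Shift) (h : S.adm a (ω.1 0)) : S.Shift :=
  ⟨fun n => Nat.casesOn n a ω.1, fun n => by
    cases n with
    | zero => exact h
    | succ n => exact ω.2 n⟩

lemma abs_g_sub_le {a b : A} (h : S.adm a b) {x y : ℝ} (hx : x ∈ S.I b) (hy : y ∈ S.I b) :
    |S.g a b x - S.g a b y| ≤ S.κ * |x - y| := by
  obtain ⟨m, -, -, hm⟩ := S.contraction a b h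
  have := Convex.norm_image_sub_le_of_norm_deriv_le (𝕜 := ℝ) (f := S.g a b) (C := S.κ)
    (s := Ioo (S.lo b) (S.hi b))
    (fun z hz => ((S.contDiffOn a b h).differentiableOn (by norm_num)).differentiableAt
      (isOpen_Ioo.mem_nhds hz)) (fun z hz => (hm z hz).2) (convex_Ioo _ _) hy hx
  simpa [Real.norm_eq_abs] using this

lemma wordInterval_subset (n : ℕ) : ∀ ω : S.Shift, S.wordInterval n ω.1 ⊆ S.I (ω.1 0) := by
  induction n with
  | zero => exact fun ω => subset_rfl
  | succ n ih =>
    intro ω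
    rintro _ ⟨x, hx, rfl⟩
    exact S.mapsTo _ _ (ω.2 0) (ih ⟨fun k => ω.1 (k + 1), fun k => ω.2 (k + 1)⟩ hx)

lemma wordInterval_nonempty (n : ℕ) : ∀ w : ℕ → A, (S.wordInterval n w).Nonempty := by
  induction n with
  | zero => exact fun w => nonempty_Ioo.2 (S.lo_lt_hi _)
  | succ n ih => exact fun w => (ih _).image _

lemma wordInterval_succ_subset (n : ℕ) :
    ∀ ω : S.Shift, S.wordInterval (n + 1) ω.1 ⊆ S.wordInterval n ω.1 := by
  induction n with
  | zero => exact fun ω => S.wordInterval_subset 1 ω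
  | succ n ih =>
    exact fun ω => image_mono (ih ⟨fun k => ω.1 (k + 1), fun k => ω.2 (k + 1)⟩)

lemma abs_sub_le_of_mem_wordInterval (n : ℕ) : ∀ ω : S.Shift, ∀ x ∈ S.wordInterval n ω.1,
    ∀ y ∈ S.wordInterval n ω.1, |x - y| ≤ S.κ ^ n := by
  induction n with
  | zero =>
    intro ω x hx y hy
    have h0 := S.lo_nonneg (ω.1 0)
    have h1 := S.hi_le_one (ω.1 0)
    rw [pow_zero, abs_le]
    constructor <;> linarith [hx.1, hx.2, hy.1, hy.2]
  | succ n ih =>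
    intro ω
    rintro _ ⟨x, hx, rfl⟩ _ ⟨y, hy, rfl⟩
    let ω' : S.Shift := ⟨fun k => ω.1 (k + 1), fun k => ω.2 (k + 1)⟩
    have h1 := S.abs_g_sub_le (ω.2 0) (S.wordInterval_subset n ω' hx)
      (S.wordInterval_subset n ω' hy)
    have h2 := ih ω' x hx y hy
    calc _ ≤ S.κ * |x - y| := h1
      _ ≤ S.κ * S.κ ^ n := mul_le_mul_of_nonneg_left h2 S.κ_pos.le
      _ = S.κ ^ (n + 1) := by ring

/-- An admissible infinite word codes exactly one point. -/
theorem existsUnique_coding (ω : S.Shift) :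
    ∃! x : ℝ, ∀ n, x ∈ closure (S.wordInterval n ω.1) := by
  have hc : IsCompact (closure (S.wordInterval 0 ω.1)) :=
    (Metric.isBounded_Ioo (S.lo (ω.1 0)) (S.hi (ω.1 0))).isCompact_closure
  obtain ⟨x, hx⟩ := IsCompact.nonempty_iInter_of_sequence_nonempty_isCompact_isClosed
    (fun n => closure (S.wordInterval n ω.1))
    (fun n => closure_mono (S.wordInterval_succ_subset n ω))
    (fun n => (S.wordInterval_nonempty n ω.1).closure) hc (fun n => isClosed_closure)
  refine ⟨x, mem_iInter.1 hx, fun y hy => ?_⟩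
  have key : ∀ n, dist y x ≤ S.κ ^ n := by
    intro n
    have hs : S.wordInterval n ω.1 ×ˢ S.wordInterval n ω.1 ⊆
        {p : ℝ × ℝ | dist p.1 p.2 ≤ S.κ ^ n} := fun p hp =>
      S.abs_sub_le_of_mem_wordInterval n ω p.1 hp.1 p.2 hp.2
    have hcl : IsClosed {p : ℝ × ℝ | dist p.1 p.2 ≤ S.κ ^ n} :=
      isClosed_le (continuous_fst.dist continuous_snd) continuous_const
    have := closure_minimal hs hcl
    rw [closure_prod_eq] at this
    exact this (mk_mem_prod (hy n) (mem_iInter.1 hx n))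
  have hlim := tendsto_pow_atTop_nhds_zero_of_lt_one S.κ_pos.le S.κ_lt_one
  exact dist_le_zero.1 (ge_of_tendsto' hlim key)

/-- The projection `π` from the symbolic space to the attractor: `π(ω)` is the unique point of
`⋂_n closure I_{ω_0 … ω_n}`. -/
noncomputable def coding (ω : S.Shift) : ℝ := (S.existsUnique_coding ω).choose

/-- The potential `φ` has summable variations: `∑_{n ≥ 2} var_n(φ) < ∞`, where `var_n(φ)` is the
largest oscillation of `φ` over a cylinder of length `n`. -/
def SummableVariations (φ : S.Shift → ℝ) : Prop :=
  ∑' n : ℕ, (⨆ (ω : S.Shift) (η : S.Shift) (_ : ∀ i < n + 2, ω.1 i = η.1 i),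
    ENNReal.ofReal |φ ω - φ η|) < ∞

open Classical in
/-- The function `ω ↦ e^{φ(aω)} f(aω)`, extended by `0` to the `ω` for which `aω` is not
admissible. -/
noncomputable def branchTerm (φ f : S.Shift → ℝ) (a : A) (ω : S.Shift) : ℝ :=
  if h : S.adm a (ω.1 0) then Real.exp (φ (S.cons a ω h)) * f (S.cons a ω h) else 0

/-- The potential `φ` is normalised: `φ < 0`, and the transfer operator
`L_φ f (ω) = ∑_{a : aω admissible} e^{φ(aω)} f(aω)` fixes the constant function `1`. -/
def Normalized (φ : S.Shift → ℝ) : Prop :=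
  (∀ ω, φ ω < 0) ∧ ∀ ω, HasSum (fun a => S.branchTerm φ (fun _ => 1) a ω) 1

/-- The light `γ₀`-tail condition
`∑_a sup_{b : ab admissible} sup_{ω ∈ [b], x ∈ I_b} e^{φ(aω)} |g_{ab}'(x)|^{-γ₀} < ∞`. -/
def LightTail (φ : S.Shift → ℝ) (γ₀ : ℝ) : Prop :=
  ∑' a : A, (⨆ (ω : S.Shift) (h : S.adm a (ω.1 0)) (x ∈ S.I (ω.1 0)),
    ENNReal.ofReal (Real.exp (φ (S.cons a ω h)) * |deriv (S.g a (ω.1 0)) x| ^ (-γ₀))) < ∞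

/-- `ν` is a symbolic Gibbs measure of the potential `φ`: it is a probability measure with
`∫ f dν = ∑_{ab admissible} ∫_{[b]} e^{φ(aω)} f(aω) dν(ω)` for all bounded continuous `f`. -/
def IsGibbs [TopologicalSpace A] [MeasurableSpace A] (φ : S.Shift → ℝ) (ν : Measure S.Shift) :
    Prop :=
  IsProbabilityMeasure ν ∧ ∀ f : BoundedContinuousFunction S.Shift ℝ,
    HasSum (fun p : A × A => ∫ ω in {ω : S.Shift | ω.1 0 = p.2}, S.branchTerm φ f p.1 ω ∂ν)
      (∫ ω, f ω ∂ν)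

/-- The potential is locally constant with Bernoulli weights: `e^{φ(ω)} = p_{ω_0}` for a
probability vector `p` with positive entries. -/
def IsBernoulli (φ : S.Shift → ℝ) : Prop :=
  ∃ p : A → ℝ, (∀ a, 0 < p a) ∧ HasSum p 1 ∧ ∀ ω : S.Shift, Real.exp (φ ω) = p (ω.1 0)

end MarkovIFS

/-! Both cases reduce to a single estimate at every scale `k`: `ν (π⁻¹ J) ≤ K θ ^ k + Z L ^ k |J| ^
γ` with `θ < 1`. Taking `k` proportional to `log (1 / |J|)`, with a factor small enough that `L ^ k
|J| ^ γ ≤ θ ^ k`, turns this into a power of `|J|` (`exists_rpow_bound`).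

The second term bounds the words that contract too much. The light tail gives `|g'| ≥ ratio`, where
`ratio` is defined so that `e ^ φ * ratio ^ (-γ)` is exactly the summand of the first letter in the
tail condition. Iterating the Gibbs identity therefore bounds the moment of order `-γ` of a product
of `n` ratios by the `n`-th power of the tail sum, and Markov's inequality applies
(`IsGibbs.measure_ratioProd_le`).

The first term bounds the remaining words. Without overlaps, such a word has a word interval too
long to fit in `J`, so its closure contains an endpoint of `J`. At most two words of given length do
this for each endpoint, and cylinders have exponentially small mass
(`IsGibbs.exists_measure_cylinder_le`).

With Bernoulli weights the shift is full, and since `F` is not a point there are two words `v`, `v'`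
of equal length whose codes stay a fixed distance apart (`exists_separated_words`). As long as the
contraction along a prefix keeps this gap longer than `J`, the preimage of `J` misses the
continuation by `v` or the one by `v'`. Each block of letters thus costs a fixed proportion of the
mass, with no separation of the intervals needed. -/

namespace MarkovIFS

open Filter Topology

/-! ### Symbolic space: shift, prepending a letter, continuity. -/

section Symbolic

variable {A : Type*} (S : MarkovIFS A)

/-- The left shift on admissible words. -/
def shift (ω : S.Shift) : S.Shift := ⟨fun k => ω.1 (k + 1), fun k => ω.2 (k + 1)⟩

/-- The words `ω` for which `aω` is admissible. -/
def precedes (a : A) : Set S.Shift := {ω | S.adm a (ω.1 0)}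

open Classical in
/-- The word `aω`, with junk value `ω` if `aω` is not admissible. -/
noncomputable def prepend (a : A) (ω : S.Shift) : S.Shift :=
  if h : S.adm a (ω.1 0) then S.cons a ω h else ω

variable {S}

lemma prepend_eq {a : A} {ω : S.Shift} (h : S.adm a (ω.1 0)) : S.prepend a ω = S.cons a ω h :=
  dif_pos h

lemma prepend_zero {a : A} {ω : S.Shift} (h : ω ∈ S.precedes a) : (S.prepend a ω).1 0 = a := by
  rw [prepend_eq h]; rfl

lemma shift_prepend {a : A} {ω : S.Shift} (h : ω ∈ S.precedes a) :
    S.shift (S.prepend a ω) = ω := by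
  rw [prepend_eq h]; rfl

lemma prepend_head_shift (ω : S.Shift) : S.prepend (ω.1 0) (S.shift ω) = ω := by
  rw [prepend_eq (a := ω.1 0) (ω := S.shift ω) (ω.2 0)]
  apply Subtype.ext
  funext n
  cases n <;> rfl

variable {φ : S.Shift → ℝ}

lemma ofReal_branchTerm (f : S.Shift → ℝ) (a : A) (ω : S.Shift) :
    ENNReal.ofReal (S.branchTerm φ f a ω) = (S.precedes a).indicator (fun ω =>
      ENNReal.ofReal (Real.exp (φ (S.prepend a ω))) * ENNReal.ofReal (f (S.prepend a ω))) ω := by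
  by_cases hω : ω ∈ S.precedes a
  · have hω' : S.adm a (ω.1 0) := hω
    rw [indicator_of_mem hω, branchTerm, dif_pos hω', prepend_eq hω',
      ENNReal.ofReal_mul (Real.exp_pos _).le]
  · have hω' : ¬ S.adm a (ω.1 0) := hω
    rw [indicator_of_notMem hω, branchTerm, dif_neg hω', ENNReal.ofReal_zero]

lemma branchTerm_nonneg {f : S.Shift → ℝ} (hf : ∀ ω, 0 ≤ f ω) (a : A) (ω : S.Shift) :
    0 ≤ S.branchTerm φ f a ω := by
  unfold branchTerm
  split_ifs
  · exact mul_nonneg (Real.exp_pos _).le (hf _)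
  · exact le_rfl

lemma branchTerm_le (hn : S.Normalized φ) {f : S.Shift → ℝ} {M : ℝ} (hM : 0 ≤ M)
    (hf : ∀ ω, f ω ≤ M) (a : A) (ω : S.Shift) : S.branchTerm φ f a ω ≤ M := by
  unfold branchTerm
  split_ifs with h
  · calc _ ≤ Real.exp (φ (S.cons a ω h)) * M :=
          mul_le_mul_of_nonneg_left (hf _) (Real.exp_pos _).le
      _ ≤ 1 * M := mul_le_mul_of_nonneg_right (Real.exp_le_one_iff.2 (hn.1 _).le) hM
      _ = M := one_mul M
  · exact hM

variable [TopologicalSpace A]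

lemma continuous_letter (k : ℕ) : Continuous fun ω : S.Shift => ω.1 k :=
  (continuous_apply k).comp continuous_subtype_val

lemma continuous_shift : Continuous S.shift :=
  Continuous.subtype_mk (continuous_pi fun k => continuous_letter (k + 1)) _

variable [DiscreteTopology A]

lemma isClopen_precedes (a : A) : IsClopen (S.precedes a) :=
  (isClopen_discrete {b | S.adm a b}).preimage (continuous_letter 0)

lemma continuous_prepend (a : A) : Continuous (S.prepend a) := by
  classical
  have h1 : ContinuousOn (S.prepend a) (S.precedes a) := by
    rw [continuousOn_iff_continuous_domRestrict]
    have hc : Continuous fun ω : S.precedes a => (S.prepend a ω.1).1 := ?_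
    · exact hc.subtype_mk fun ω => (S.prepend a ω.1).2
    refine continuous_pi fun n => ?_
    cases n with
    | zero =>
      refine continuous_const (y := a) |>.congr fun ω => ?_
      exact (prepend_zero ω.2).symm
    | succ n =>
      refine ((continuous_letter (S := S) n).comp continuous_subtype_val).congr fun ω => ?_
      have := shift_prepend ω.2
      exact (congrFun (congrArg Subtype.val this) n).symm
  have h2 : ContinuousOn (S.prepend a) (S.precedes a)ᶜ := by
    refine continuousOn_id.congr fun ω hω => ?_
    exact dif_neg hω
  rw [continuous_iff_continuousAt]
  intro ω
  by_cases hω : ω ∈ S.precedes a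
  · exact h1.continuousAt ((isClopen_precedes a).isOpen.mem_nhds hω)
  · exact h2.continuousAt ((isClopen_precedes a).compl.isOpen.mem_nhds hω)

lemma isOpen_agree (n : ℕ) (w : ℕ → A) : IsOpen {ω : S.Shift | ∀ i < n, ω.1 i = w i} := by
  have : {ω : S.Shift | ∀ i < n, ω.1 i = w i} =
      ⋂ i ∈ Set.Iio n, {ω : S.Shift | ω.1 i = w i} := by
    ext; simp
  rw [this]
  refine (Set.finite_Iio n).isOpen_biInter fun i _ => ?_
  exact (isOpen_discrete {w i}).preimage (continuous_letter i)

/-- A potential with summable variations is continuous. -/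
lemma SummableVariations.continuous {φ : S.Shift → ℝ} (h : S.SummableVariations φ) :
    Continuous φ := by
  have h0 := ENNReal.tendsto_atTop_zero_of_tsum_ne_top h.ne
  rw [continuous_iff_continuousAt]
  intro ω
  rw [ContinuousAt, Metric.tendsto_nhds]
  intro ε hε
  obtain ⟨n, hn⟩ := (h0.eventually_lt_const (ENNReal.ofReal_pos.2 hε)).exists
  filter_upwards [(isOpen_agree (n + 2) ω.1).mem_nhds (fun i _ => rfl)] with η hη
  rw [Real.dist_eq, ← ENNReal.ofReal_lt_ofReal_iff hε]
  refine lt_of_le_of_lt ?_ hn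
  exact le_iSup₂_of_le η ω (le_iSup_of_le hη le_rfl)

end Symbolic

/-! ### The Gibbs identity for nonnegative measurable functions. -/

section Gibbs

variable {A : Type*} [Countable A] [TopologicalSpace A] [DiscreteTopology A]
  [MeasurableSpace A] [DiscreteMeasurableSpace A] {S : MarkovIFS A} {φ : S.Shift → ℝ}
  {ν : Measure S.Shift}

lemma measurableSet_precedes (a : A) : MeasurableSet (S.precedes a) :=
  (isClopen_precedes a).isOpen.measurableSet

lemma measurable_branch (hφ : Continuous φ) (a : A) {f : S.Shift → ℝ≥0∞} (hf : Measurable f) :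
    Measurable ((S.precedes a).indicator fun ω =>
      ENNReal.ofReal (Real.exp (φ (S.prepend a ω))) * f (S.prepend a ω)) := by
  have h1 : Measurable (S.prepend a) := (continuous_prepend a).measurable
  have h2 : Measurable φ := hφ.measurable
  exact Measurable.indicator (by fun_prop) (measurableSet_precedes a)

/-- The part of the Gibbs measure carried by the words that begin with `a`. -/
noncomputable def branchMeasure (φ : S.Shift → ℝ) (ν : Measure S.Shift) (a : A) :
    Measure S.Shift :=
  (ν.withDensity ((S.precedes a).indicator fun ω =>
      ENNReal.ofReal (Real.exp (φ (S.prepend a ω))))).map (S.prepend a)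

lemma lintegral_branchMeasure (hφ : Continuous φ) (a : A) {f : S.Shift → ℝ≥0∞}
    (hf : Measurable f) :
    ∫⁻ ω, f ω ∂(branchMeasure φ ν a) = ∫⁻ ω, (S.precedes a).indicator (fun ω =>
      ENNReal.ofReal (Real.exp (φ (S.prepend a ω))) * f (S.prepend a ω)) ω ∂ν := by
  have h1 : Measurable (S.prepend a) := (continuous_prepend a).measurable
  have h2 := measurable_branch hφ a (measurable_const (a := (1 : ℝ≥0∞)))
  simp only [mul_one] at h2
  rw [branchMeasure, lintegral_map hf h1, lintegral_withDensity_eq_lintegral_mul _ h2 (by fun_prop)]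
  refine lintegral_congr fun ω => ?_
  by_cases hω : ω ∈ S.precedes a <;> simp [hω]

lemma measurable_branchTerm (hφ : Continuous φ) {f : S.Shift → ℝ} (hf : Measurable f) (a : A) :
    Measurable (S.branchTerm φ f a) := by
  have h1 : Measurable (S.prepend a) := (continuous_prepend a).measurable
  have h2 : Measurable φ := hφ.measurable
  have : S.branchTerm φ f a = (S.precedes a).indicator
      fun ω => Real.exp (φ (S.prepend a ω)) * f (S.prepend a ω) := by
    funext ω
    by_cases hω : ω ∈ S.precedes a
    · have hω' : S.adm a (ω.1 0) := hω
      rw [indicator_of_mem hω, branchTerm, dif_pos hω', prepend_eq hω']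
    · have hω' : ¬ S.adm a (ω.1 0) := hω
      rw [indicator_of_notMem hω, branchTerm, dif_neg hω']
  rw [this]
  exact Measurable.indicator (by fun_prop) (measurableSet_precedes a)

lemma lintegral_eq_tsum_letter (f : S.Shift → ℝ≥0∞) :
    ∫⁻ ω, f ω ∂ν = ∑' b : A, ∫⁻ ω in {ω : S.Shift | ω.1 0 = b}, f ω ∂ν := by
  rw [← lintegral_iUnion (s := fun b : A => {ω : S.Shift | ω.1 0 = b})
    (fun b => (continuous_letter 0).measurable (measurableSet_singleton b))
    (fun b c hbc => Set.disjoint_left.2 fun ω (h1 : _ = b) (h2 : _ = c) => hbc (h1.symm.trans h2))]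
  have : (⋃ b : A, {ω : S.Shift | ω.1 0 = b}) = univ := by ext; simp
  rw [this, Measure.restrict_univ]

/-- The Gibbs property says that the two measures have equal integrals of bounded continuous
functions. On a pseudometrizable space finite measures are determined by these, so the identity
passes to measurable functions. -/
lemma IsGibbs.sum_branchMeasure (hν : S.IsGibbs φ ν) (hφ : Continuous φ) (hn : S.Normalized φ) :
    Measure.sum (branchMeasure φ ν) = ν := by
  have := hν.1
  have key : ∀ f : BoundedContinuousFunction S.Shift NNReal,
      ∫⁻ ω, f ω ∂ν = ∫⁻ ω, f ω ∂(Measure.sum (branchMeasure φ ν)) := by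
    intro f
    have hfm : Measurable f := f.continuous.measurable
    let g : BoundedContinuousFunction S.Shift ℝ :=
      BoundedContinuousFunction.ofNormedAddCommGroup (fun ω => (f ω : ℝ)) (by fun_prop) (nndist f 0)
        (fun ω => by
          have := f.dist_coe_le_dist (g := 0) ω
          simpa [NNReal.dist_eq] using this)
    have hg : ∀ ω, g ω = (f ω : ℝ) := fun ω => rfl
    have hg0 : ∀ ω, 0 ≤ g ω := fun ω => (f ω).2
    have hgM : ∀ ω, g ω ≤ ‖g‖ := fun ω => (le_abs_self _).trans (g.norm_coe_le_norm ω)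
    have hbi : ∀ a, Integrable (S.branchTerm φ g a) ν := fun a =>
      Integrable.of_bound (measurable_branchTerm hφ g.continuous.measurable a).aestronglyMeasurable
        ‖g‖ (Eventually.of_forall fun ω => by
          rw [Real.norm_of_nonneg (branchTerm_nonneg hg0 a ω)]
          exact branchTerm_le hn (norm_nonneg _) hgM a ω)
    have hsum := hν.2 g
    have h1 : ∫⁻ ω, f ω ∂ν = ENNReal.ofReal (∫ ω, g ω ∂ν) := by
      rw [ofReal_integral_eq_lintegral_ofReal (g.integrable ν) (Eventually.of_forall hg0)]
      exact lintegral_congr fun ω => by simp [hg]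
    rw [h1, ← hsum.tsum_eq, ENNReal.ofReal_tsum_of_nonneg
      (fun p => integral_nonneg fun ω => branchTerm_nonneg hg0 _ _) hsum.summable,
      ENNReal.tsum_prod (f := fun a b =>
        ENNReal.ofReal (∫ ω in {ω : S.Shift | ω.1 0 = b}, S.branchTerm φ g a ω ∂ν)), lintegral_sum_measure]
    refine tsum_congr fun a => ?_
    rw [lintegral_branchMeasure hφ a (by fun_prop), lintegral_eq_tsum_letter]
    refine tsum_congr fun b => ?_
    rw [ofReal_integral_eq_lintegral_ofReal (hbi a).integrableOn
      (Eventually.of_forall fun ω => branchTerm_nonneg hg0 _ _)]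
    refine lintegral_congr fun ω => ?_
    rw [ofReal_branchTerm]
    simp [hg]
  have h1 : (Measure.sum (branchMeasure φ ν)) univ = 1 := by
    have := key 1
    simpa using this.symm
  have : TopologicalSpace.PseudoMetrizableSpace (ℕ → A) := inferInstance
  have : TopologicalSpace.PseudoMetrizableSpace S.Shift :=
    Topology.IsInducing.subtypeVal.pseudoMetrizableSpace
  have : IsFiniteMeasure (Measure.sum (branchMeasure φ ν)) := ⟨by rw [h1]; simp⟩
  exact (ext_of_forall_lintegral_eq_of_IsFiniteMeasure key).symm

/-- The Gibbs property for nonnegative measurable functions. -/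
theorem IsGibbs.lintegral_eq (hν : S.IsGibbs φ ν) (hφ : Continuous φ) (hn : S.Normalized φ)
    {f : S.Shift → ℝ≥0∞} (hf : Measurable f) :
    ∫⁻ ω, f ω ∂ν = ∑' a : A, ∫⁻ ω, (S.precedes a).indicator (fun ω =>
      ENNReal.ofReal (Real.exp (φ (S.prepend a ω))) * f (S.prepend a ω)) ω ∂ν := by
  conv_lhs => rw [← hν.sum_branchMeasure hφ hn]
  rw [lintegral_sum_measure]
  exact tsum_congr fun a => lintegral_branchMeasure hφ a hf

end Gibbs

/-! ### Lower bounds for contraction, and the coding map. -/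

section Geometry

variable {A : Type*} (S : MarkovIFS A)

/-- The summand of the letter `a` in the light tail condition. -/
noncomputable def tailSup (φ : S.Shift → ℝ) (γ : ℝ) (a : A) : ℝ≥0∞ :=
  ⨆ (ω : S.Shift) (h : S.adm a (ω.1 0)) (x ∈ S.I (ω.1 0)),
    ENNReal.ofReal (Real.exp (φ (S.cons a ω h)) * |deriv (S.g a (ω.1 0)) x| ^ (-γ))

/-- The lower bound for the contraction of the branch `g_{ω₀ω₁}` that the light tail gives. -/
noncomputable def ratio (φ : S.Shift → ℝ) (γ : ℝ) (ω : S.Shift) : ℝ :=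
  (Real.exp (φ ω) / (S.tailSup φ γ (ω.1 0)).toReal) ^ γ⁻¹

/-- The product of `h (σⁿω)` with the lower bounds for the contractions of the first `n`
branches. -/
noncomputable def ratioProd (φ : S.Shift → ℝ) (γ : ℝ) (h : S.Shift → ℝ) : ℕ → S.Shift → ℝ
  | 0, ω => h ω
  | n + 1, ω => S.ratio φ γ ω * ratioProd φ γ h n (S.shift ω)

variable {S} {φ : S.Shift → ℝ} {γ : ℝ}

lemma LightTail.tsum_ne_top (ht : S.LightTail φ γ) : ∑' a, S.tailSup φ γ a ≠ ∞ := ht.ne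

lemma LightTail.tailSup_ne_top (ht : S.LightTail φ γ) (a : A) : S.tailSup φ γ a ≠ ∞ :=
  ENNReal.ne_top_of_tsum_ne_top ht.tsum_ne_top a

lemma cons_shift (ω : S.Shift) : S.cons (ω.1 0) (S.shift ω) (ω.2 0) = ω := by
  have := prepend_head_shift ω
  rwa [prepend_eq (a := ω.1 0) (ω := S.shift ω) (ω.2 0)] at this

lemma le_tailSup (φ : S.Shift → ℝ) (γ : ℝ) (ω : S.Shift) {x : ℝ} (hx : x ∈ S.I (ω.1 1)) :
    ENNReal.ofReal (Real.exp (φ ω) * |deriv (S.g (ω.1 0) (ω.1 1)) x| ^ (-γ)) ≤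
      S.tailSup φ γ (ω.1 0) := by
  have h : ENNReal.ofReal (Real.exp (φ (S.cons (ω.1 0) (S.shift ω) (ω.2 0))) *
      |deriv (S.g (ω.1 0) (ω.1 1)) x| ^ (-γ)) ≤ S.tailSup φ γ (ω.1 0) :=
    le_iSup_of_le (S.shift ω) (le_iSup₂_of_le (ω.2 0) x (le_iSup_of_le hx le_rfl))
  rwa [cons_shift] at h

lemma I_nonempty (a : A) : (S.I a).Nonempty := nonempty_Ioo.2 (S.lo_lt_hi a)

lemma deriv_pos {a b : A} (h : S.adm a b) {x : ℝ} (hx : x ∈ S.I b) :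
    0 < |deriv (S.g a b) x| ∧ |deriv (S.g a b) x| < 1 := by
  obtain ⟨m, hm, -, h2⟩ := S.contraction a b h
  exact ⟨hm.trans_le (h2 x hx).1, (h2 x hx).2.trans_lt S.κ_lt_one⟩

lemma LightTail.le_toReal (ht : S.LightTail φ γ) (ω : S.Shift) {x : ℝ}
    (hx : x ∈ S.I (ω.1 1)) :
    Real.exp (φ ω) * |deriv (S.g (ω.1 0) (ω.1 1)) x| ^ (-γ) ≤
      (S.tailSup φ γ (ω.1 0)).toReal :=
  (ENNReal.ofReal_le_iff_le_toReal (ht.tailSup_ne_top _)).1 (le_tailSup φ γ ω hx)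

lemma LightTail.exp_le (ht : S.LightTail φ γ) (hγ : 0 < γ) (ω : S.Shift) :
    Real.exp (φ ω) ≤ (S.tailSup φ γ (ω.1 0)).toReal := by
  obtain ⟨x, hx⟩ := I_nonempty (S := S) (ω.1 1)
  have h1 := deriv_pos (ω.2 0) hx
  refine le_trans ?_ (ht.le_toReal ω hx)
  exact le_mul_of_one_le_right (Real.exp_pos _).le
    (Real.one_le_rpow_of_pos_of_le_one_of_nonpos h1.1 h1.2.le (by linarith))

lemma LightTail.toReal_pos (ht : S.LightTail φ γ) (hγ : 0 < γ) (ω : S.Shift) :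
    0 < (S.tailSup φ γ (ω.1 0)).toReal :=
  (Real.exp_pos _).trans_le (ht.exp_le hγ ω)

lemma LightTail.ratio_pos (ht : S.LightTail φ γ) (hγ : 0 < γ) (ω : S.Shift) :
    0 < S.ratio φ γ ω :=
  Real.rpow_pos_of_pos (div_pos (Real.exp_pos _) (ht.toReal_pos hγ ω)) _

lemma LightTail.ratio_le_one (ht : S.LightTail φ γ) (hγ : 0 < γ) (ω : S.Shift) :
    S.ratio φ γ ω ≤ 1 :=
  Real.rpow_le_one (div_nonneg (Real.exp_pos _).le ENNReal.toReal_nonneg)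
    ((div_le_one (ht.toReal_pos hγ ω)).2 (ht.exp_le hγ ω)) (inv_nonneg.2 hγ.le)

/-- This equality is the reason for the form of `ratio`: the right side depends on the first letter
only, so it factors out of the Gibbs identity. -/
lemma LightTail.exp_mul_ratio_rpow (ht : S.LightTail φ γ) (hγ : 0 < γ) (ω : S.Shift) :
    Real.exp (φ ω) * S.ratio φ γ ω ^ (-γ) = (S.tailSup φ γ (ω.1 0)).toReal := by
  have h1 := ht.toReal_pos hγ ω
  rw [ratio, ← Real.rpow_mul (div_nonneg (Real.exp_pos _).le h1.le), mul_neg,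
    inv_mul_cancel₀ hγ.ne', Real.rpow_neg_one, inv_div, mul_div_cancel₀ _ (Real.exp_pos _).ne']

lemma LightTail.ratio_le_deriv (ht : S.LightTail φ γ) (hγ : 0 < γ) (ω : S.Shift) {x : ℝ}
    (hx : x ∈ S.I (ω.1 1)) : S.ratio φ γ ω ≤ |deriv (S.g (ω.1 0) (ω.1 1)) x| := by
  have h1 := (deriv_pos (ω.2 0) hx).1
  have h2 := ht.le_toReal ω hx
  rw [← ht.exp_mul_ratio_rpow hγ ω] at h2
  have h3 := le_of_mul_le_mul_left h2 (Real.exp_pos _)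
  exact (Real.rpow_le_rpow_iff_of_neg h1 (ht.ratio_pos hγ ω) (neg_lt_zero.2 hγ)).1 h3

lemma exists_deriv_eq_slope_of_mem {a b : A} (h : S.adm a b) {x y : ℝ} (hx : x ∈ S.I b)
    (hy : y ∈ S.I b) :
    ∃ z ∈ S.I b, |S.g a b x - S.g a b y| = |deriv (S.g a b) z| * |x - y| := by
  wlog hxy : x ≤ y generalizing x y
  · obtain ⟨z, hz, h1⟩ := this hy hx (le_of_not_ge hxy)
    exact ⟨z, hz, by rw [abs_sub_comm, h1, abs_sub_comm x]⟩
  rcases hxy.eq_or_lt with rfl | hlt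
  · exact ⟨x, hx, by simp⟩
  have hsub : Icc x y ⊆ S.I b := fun z hz => ⟨hx.1.trans_le hz.1, hz.2.trans_lt hy.2⟩
  have hd : DifferentiableOn ℝ (S.g a b) (S.I b) := (S.contDiffOn a b h).differentiableOn (by simp)
  obtain ⟨z, hz, h1⟩ := exists_deriv_eq_slope (S.g a b) hlt (hd.continuousOn.mono hsub)
    (hd.mono (Ioo_subset_Icc_self.trans hsub))
  refine ⟨z, hsub (Ioo_subset_Icc_self hz), ?_⟩
  have hne : y - x ≠ 0 := (sub_pos.2 hlt).ne'
  rw [h1, abs_div, abs_sub_comm x y, div_mul_cancel₀ _ (abs_ne_zero.2 hne), abs_sub_comm]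

lemma LightTail.ratio_mul_le (ht : S.LightTail φ γ) (hγ : 0 < γ) (ω : S.Shift) {x y : ℝ}
    (hx : x ∈ S.I (ω.1 1)) (hy : y ∈ S.I (ω.1 1)) :
    S.ratio φ γ ω * |x - y| ≤ |S.g (ω.1 0) (ω.1 1) x - S.g (ω.1 0) (ω.1 1) y| := by
  obtain ⟨z, hz, h1⟩ := exists_deriv_eq_slope_of_mem (ω.2 0) hx hy
  rw [h1]
  exact mul_le_mul_of_nonneg_right (ht.ratio_le_deriv hγ ω hz) (abs_nonneg _)

lemma LightTail.ratioProd_pos (ht : S.LightTail φ γ) (hγ : 0 < γ) {h : S.Shift → ℝ}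
    (hh : ∀ ω, 0 < h ω) (n : ℕ) : ∀ ω, 0 < S.ratioProd φ γ h n ω := by
  induction n with
  | zero => exact hh
  | succ n ih => exact fun ω => mul_pos (ht.ratio_pos hγ ω) (ih _)

/-- Half the length of `I_{ω₀}`. -/
noncomputable def halfLength (ω : S.Shift) : ℝ := (S.hi (ω.1 0) - S.lo (ω.1 0)) / 2

lemma halfLength_pos (ω : S.Shift) : 0 < halfLength ω :=
  half_pos (sub_pos.2 (S.lo_lt_hi _))

lemma LightTail.exists_ratioProd_le (ht : S.LightTail φ γ) (hγ : 0 < γ) (n : ℕ) :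
    ∀ ω : S.Shift, ∃ x ∈ S.wordInterval n ω.1, ∃ y ∈ S.wordInterval n ω.1,
      S.ratioProd φ γ halfLength n ω ≤ |x - y| := by
  induction n with
  | zero =>
    intro ω
    have h := S.lo_lt_hi (ω.1 0)
    -- The interval is open, so its full length is not attained; the quarter points realise half of
    -- it.
    refine ⟨S.lo (ω.1 0) + (S.hi (ω.1 0) - S.lo (ω.1 0)) / 4, ⟨by linarith, by linarith⟩,
      S.lo (ω.1 0) + 3 * (S.hi (ω.1 0) - S.lo (ω.1 0)) / 4, ⟨by linarith, by linarith⟩, ?_⟩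
    rw [abs_sub_comm]
    refine le_trans (le_of_eq ?_) (le_abs_self _)
    simp only [ratioProd, halfLength]
    ring
  | succ n ih =>
    intro ω
    obtain ⟨x, hx, y, hy, hxy⟩ := ih (S.shift ω)
    refine ⟨_, mem_image_of_mem _ hx, _, mem_image_of_mem _ hy, ?_⟩
    refine le_trans ?_ (ht.ratio_mul_le hγ ω (S.wordInterval_subset n (S.shift ω) hx)
      (S.wordInterval_subset n (S.shift ω) hy))
    exact mul_le_mul_of_nonneg_left hxy (ht.ratio_pos hγ ω).le

lemma ordConnected_wordInterval (n : ℕ) : ∀ ω : S.Shift, (S.wordInterval n ω.1).OrdConnected := by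
  induction n with
  | zero => exact fun ω => ordConnected_Ioo
  | succ n ih =>
    intro ω
    have hc : ContinuousOn (S.g (ω.1 0) (ω.1 1)) (S.I (ω.1 1)) :=
      (S.contDiffOn _ _ (ω.2 0)).continuousOn
    exact ((ih (S.shift ω)).isPreconnected.image _
      (hc.mono (S.wordInterval_subset n (S.shift ω)))).ordConnected

lemma coding_mem (ω : S.Shift) (n : ℕ) : S.coding ω ∈ closure (S.wordInterval n ω.1) :=
  (S.existsUnique_coding ω).choose_spec.1 n

lemma wordInterval_congr (n : ℕ) : ∀ v w : ℕ → A, (∀ i ≤ n, v i = w i) →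
    S.wordInterval n v = S.wordInterval n w := by
  induction n with
  | zero => intro v w h; simp only [wordInterval, h 0 le_rfl]
  | succ n ih =>
    intro v w h
    simp only [wordInterval]
    rw [h 0 (by omega), h 1 (by omega), ih _ _ fun i hi => h (i + 1) (by omega)]

lemma abs_sub_le_of_mem_closure (n : ℕ) (ω : S.Shift) {x y : ℝ}
    (hx : x ∈ closure (S.wordInterval n ω.1)) (hy : y ∈ closure (S.wordInterval n ω.1)) :
    |x - y| ≤ S.κ ^ n := by
  have hs : S.wordInterval n ω.1 ×ˢ S.wordInterval n ω.1 ⊆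
      {p : ℝ × ℝ | |p.1 - p.2| ≤ S.κ ^ n} := fun p hp =>
    S.abs_sub_le_of_mem_wordInterval n ω p.1 hp.1 p.2 hp.2
  have hcl : IsClosed {p : ℝ × ℝ | |p.1 - p.2| ≤ S.κ ^ n} :=
    isClosed_le (by fun_prop) continuous_const
  have := closure_minimal hs hcl
  rw [closure_prod_eq] at this
  exact this (mk_mem_prod hx hy)

lemma abs_coding_sub_le (n : ℕ) (ω η : S.Shift) (h : ∀ i ≤ n, ω.1 i = η.1 i) :
    |S.coding ω - S.coding η| ≤ S.κ ^ n := by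
  refine abs_sub_le_of_mem_closure n ω (coding_mem ω n) ?_
  rw [wordInterval_congr n _ _ h]
  exact coding_mem η n

lemma tendsto_pow_kappa : Tendsto (fun n => S.κ ^ n) atTop (𝓝 0) :=
  tendsto_pow_atTop_nhds_zero_of_lt_one S.κ_pos.le S.κ_lt_one

/-- Points of the word intervals of `ω` approximate `π(ω)`. -/
lemma tendsto_coding (ω : S.Shift) {x : ℕ → ℝ} (hx : ∀ n, x n ∈ S.wordInterval n ω.1) :
    Tendsto x atTop (𝓝 (S.coding ω)) := by
  rw [tendsto_iff_dist_tendsto_zero]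
  exact squeeze_zero (fun _ => dist_nonneg)
    (fun n => abs_sub_le_of_mem_closure n ω (subset_closure (hx n)) (coding_mem ω n))
    tendsto_pow_kappa

lemma tendsto_g_coding (ω : S.Shift) {x : ℕ → ℝ}
    (hx : ∀ n, x n ∈ S.wordInterval n (S.shift ω).1) :
    Tendsto (fun n => S.g (ω.1 0) (ω.1 1) (x n)) atTop (𝓝 (S.coding ω)) := by
  rw [tendsto_iff_dist_tendsto_zero]
  refine squeeze_zero (fun _ => dist_nonneg) (fun n => ?_) (tendsto_pow_kappa (S := S))
  refine (abs_sub_le_of_mem_closure (n + 1) ω (subset_closure (mem_image_of_mem _ (hx n)))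
    (coding_mem ω _)).trans ?_
  exact pow_le_pow_of_le_one S.κ_pos.le S.κ_lt_one.le (Nat.le_succ n)

/-- The points `π(σω)`, `π(ση)` may be endpoints of `I_b`, where nothing is known about `g`. The
inequality is proved at nearby points of the word intervals and passed to the limit. -/
lemma LightTail.ratio_mul_coding_le (ht : S.LightTail φ γ) (hγ : 0 < γ) (ω η : S.Shift)
    (h0 : ω.1 0 = η.1 0) (h1 : ω.1 1 = η.1 1) :
    S.ratio φ γ ω * |S.coding (S.shift ω) - S.coding (S.shift η)| ≤
      |S.coding ω - S.coding η| := by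
  choose x hx using fun n => S.wordInterval_nonempty n (S.shift ω).1
  choose y hy using fun n => S.wordInterval_nonempty n (S.shift η).1
  refine le_of_tendsto_of_tendsto'
    (((tendsto_coding _ hx).sub (tendsto_coding _ hy)).abs.const_mul _)
    ((tendsto_g_coding ω hx).sub (tendsto_g_coding η hy)).abs fun n => ?_
  rw [← h0, ← h1]
  refine ht.ratio_mul_le hγ ω (S.wordInterval_subset n _ (hx n)) ?_
  rw [h1]
  exact S.wordInterval_subset n _ (hy n)

variable [TopologicalSpace A] [DiscreteTopology A]

lemma continuous_coding : Continuous S.coding := by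
  rw [continuous_iff_continuousAt]
  intro ω
  rw [ContinuousAt, Metric.tendsto_nhds]
  intro ε hε
  obtain ⟨n, hn⟩ := ((tendsto_pow_kappa (S := S)).eventually_lt_const hε).exists
  filter_upwards [(isOpen_agree (n + 1) ω.1).mem_nhds (fun i _ => rfl)] with η hη
  exact (abs_coding_sub_le n η ω fun i hi => hη i (by omega)).trans_lt hn

end Geometry

/-- A drift condition outside a finite set of letters bounds a finite sum. -/
lemma tsum_le_of_drift {A : Type*} {Y k C : A → ℝ≥0∞} {X : ℝ≥0∞} (B : Finset A) (hX : X ≠ ∞)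
    (hXY : X = ∑' a, Y a) (hY1 : ∀ a, Y a ≤ k a) (hY2 : ∀ a, Y a ≤ C a * X)
    (hB : ∑' a : {a // a ∉ B}, C a ≤ 2⁻¹) : X ≤ 2 * ∑ a ∈ B, k a := by
  -- Letters in `B` contribute at most `k`, the others together at most half of `X`. This half can
  -- be absorbed since `X` is finite.
  have hXK : X ≤ ∑ a ∈ B, k a + 2⁻¹ * X := by
    calc X = ∑ a ∈ B, Y a + ∑' a : {a // a ∉ B}, Y a := by
          rw [hXY]
          exact (ENNReal.sum_add_tsum_compl B Y).symm
      _ ≤ ∑ a ∈ B, k a + (∑' a : {a // a ∉ B}, C a) * X := by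
          rw [← ENNReal.tsum_mul_right]
          exact add_le_add (Finset.sum_le_sum fun a _ => hY1 a)
            (ENNReal.tsum_le_tsum fun a => hY2 a)
      _ ≤ _ := add_le_add le_rfl (mul_le_mul_left hB X)
  have h2 : X = 2⁻¹ * X + 2⁻¹ * X := by
    rw [← add_mul, ENNReal.inv_two_add_inv_two, one_mul]
  have h3 : 2⁻¹ * X ≤ ∑ a ∈ B, k a := by
    have h4 : 2⁻¹ * X ≠ ∞ := ENNReal.mul_ne_top (by simp) hX
    rw [← ENNReal.add_le_add_iff_right h4, ← h2]
    exact hXK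
  calc X = 2 * (2⁻¹ * X) := by
        rw [← mul_assoc, ENNReal.mul_inv_cancel (by simp) (by simp), one_mul]
    _ ≤ _ := mul_le_mul_right h3 _

/-! ### Negative moments of contraction ratios and interval lengths. -/

section Estimates

variable {A : Type*} {S : MarkovIFS A} {φ : S.Shift → ℝ} {γ : ℝ}

lemma LightTail.ofReal_exp_mul (ht : S.LightTail φ γ) (hγ : 0 < γ) (ω : S.Shift) :
    ENNReal.ofReal (Real.exp (φ ω)) * ENNReal.ofReal (S.ratio φ γ ω ^ (-γ)) =
      S.tailSup φ γ (ω.1 0) := by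
  rw [← ENNReal.ofReal_mul (Real.exp_pos _).le, ht.exp_mul_ratio_rpow hγ,
    ENNReal.ofReal_toReal (ht.tailSup_ne_top _)]

lemma LightTail.one_le_ratio_rpow (ht : S.LightTail φ γ) (hγ : 0 < γ) (ω : S.Shift) :
    1 ≤ ENNReal.ofReal (S.ratio φ γ ω ^ (-γ)) := by
  rw [ENNReal.one_le_ofReal]
  exact Real.one_le_rpow_of_pos_of_le_one_of_nonpos (ht.ratio_pos hγ ω) (ht.ratio_le_one hγ ω)
    (by linarith)

/-- The branch maps `I_b` into `I_a` and contracts by no more than `ratio`. Since endpoints are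
excluded, the interval is first shrunk by `ε` on each side. This is the drift inequality for the
moment of `halfLength`. -/
lemma LightTail.ratio_mul_halfLength_le (ht : S.LightTail φ γ) (hγ : 0 < γ) (ω : S.Shift) :
    S.ratio φ γ ω * halfLength (S.shift ω) ≤ halfLength ω := by
  have key : ∀ ε > 0, ε < halfLength (S.shift ω) →
      S.ratio φ γ ω * (halfLength (S.shift ω) - ε) ≤ halfLength ω := by
    intro ε hε hε'
    simp only [halfLength] at *
    have h1 := ht.ratio_mul_le hγ ω (x := S.lo (ω.1 1) + ε) (y := S.hi (ω.1 1) - ε)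
      ⟨by linarith, by simp only [shift] at hε'; linarith⟩
      ⟨by simp only [shift] at hε'; linarith, by linarith⟩
    have h2 := S.mapsTo _ _ (ω.2 0) (show S.lo (ω.1 1) + ε ∈ Ioo (S.lo (ω.1 1)) (S.hi (ω.1 1)) from
      ⟨by linarith, by simp only [shift] at hε'; linarith⟩)
    have h3 := S.mapsTo _ _ (ω.2 0) (show S.hi (ω.1 1) - ε ∈ Ioo (S.lo (ω.1 1)) (S.hi (ω.1 1)) from
      ⟨by simp only [shift] at hε'; linarith, by linarith⟩)
    have h4 : |S.g (ω.1 0) (ω.1 1) (S.lo (ω.1 1) + ε) - S.g (ω.1 0) (ω.1 1) (S.hi (ω.1 1) - ε)| ≤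
        S.hi (ω.1 0) - S.lo (ω.1 0) := by
      rw [abs_le]; constructor <;> linarith [h2.1, h2.2, h3.1, h3.2]
    have h5 : S.hi (ω.1 1) - S.lo (ω.1 1) - 2 * ε ≤
        |S.lo (ω.1 1) + ε - (S.hi (ω.1 1) - ε)| := by
      rw [abs_sub_comm]; exact le_trans (le_of_eq (by ring)) (le_abs_self _)
    have h6 := mul_le_mul_of_nonneg_left h5 (ht.ratio_pos hγ ω).le
    simp only [shift]
    rw [show ∀ u v : ℝ, u * ((S.hi (ω.1 (0 + 1)) - v) / 2 - ε) =
      (u * (S.hi (ω.1 1) - v - 2 * ε)) / 2 from fun u v => by ring_nf]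
    simp only [zero_add]
    linarith
  have hlim : Tendsto (fun ε : ℝ => S.ratio φ γ ω * (halfLength (S.shift ω) - ε)) (𝓝[>] 0)
      (𝓝 (S.ratio φ γ ω * (halfLength (S.shift ω) - 0))) := by
    refine Tendsto.mono_left ?_ nhdsWithin_le_nhds
    exact (Continuous.tendsto (by fun_prop) 0)
  rw [sub_zero] at hlim
  refine le_of_tendsto hlim ?_
  filter_upwards [Ioo_mem_nhdsGT (halfLength_pos (S.shift ω))] with ε hε
  exact key ε hε.1 hε.2

lemma LightTail.exists_finset (ht : S.LightTail φ γ) :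
    ∃ B : Finset A, ∑' a : {a // a ∉ B}, S.tailSup φ γ a ≤ 2⁻¹ := by
  have h := ENNReal.tendsto_tsum_compl_atTop_zero ht.tsum_ne_top
  exact (h.eventually_le_const (by simp)).exists

lemma lintegral_indicator_le_of_le {X : Type*} [MeasurableSpace X] {μ : Measure X} {s : Set X}
    {f F : X → ℝ≥0∞} (h : ∀ x ∈ s, f x ≤ F x) : ∫⁻ x, s.indicator f x ∂μ ≤ ∫⁻ x, F x ∂μ :=
  lintegral_mono (indicator_le h)

variable [Countable A] [TopologicalSpace A] [DiscreteTopology A]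
  [MeasurableSpace A] [DiscreteMeasurableSpace A] {ν : Measure S.Shift}

lemma measurable_ratio (hφ : Continuous φ) : Measurable (S.ratio φ γ) := by
  have h1 : Measurable φ := hφ.measurable
  have h2 : Measurable fun ω : S.Shift => (S.tailSup φ γ (ω.1 0)).toReal :=
    (Measurable.of_discrete (f := fun a => (S.tailSup φ γ a).toReal)).comp
      (continuous_letter 0).measurable
  unfold ratio
  fun_prop

lemma measurable_ratioProd (hφ : Continuous φ) {h : S.Shift → ℝ} (hh : Measurable h) (n : ℕ) :
    Measurable (S.ratioProd φ γ h n) := by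
  induction n with
  | zero => exact hh
  | succ n ih => exact (measurable_ratio hφ).mul (ih.comp continuous_shift.measurable)

lemma measurable_halfLength : Measurable (halfLength (S := S)) :=
  (Measurable.of_discrete (f := fun a : A => (S.hi a - S.lo a) / 2)).comp
    (continuous_letter 0).measurable

/-- The moment of order `-γ` of the contraction along words of length `n`. -/
lemma IsGibbs.lintegral_ratioProd_le (hν : S.IsGibbs φ ν) (hφ : Continuous φ)
    (hn : S.Normalized φ) (ht : S.LightTail φ γ) (hγ : 0 < γ) {h : S.Shift → ℝ}
    (hh : Measurable h) (hpos : ∀ ω, 0 < h ω) (n : ℕ) :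
    ∫⁻ ω, ENNReal.ofReal (S.ratioProd φ γ h n ω ^ (-γ)) ∂ν ≤
      (∑' a, S.tailSup φ γ a) ^ n * ∫⁻ ω, ENNReal.ofReal (h ω ^ (-γ)) ∂ν := by
  induction n with
  | zero => simp [ratioProd]
  | succ n ih =>
    have hm := measurable_ratioProd (γ := γ) hφ hh
    rw [hν.lintegral_eq hφ hn (by have := hm (n + 1); fun_prop), pow_succ', mul_assoc,
      ← ENNReal.tsum_mul_right]
    refine ENNReal.tsum_le_tsum fun a => ?_
    refine le_trans ?_ (mul_le_mul_right ih _)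
    rw [← lintegral_const_mul _ (by have := hm n; fun_prop)]
    refine lintegral_indicator_le_of_le fun ω hω => ?_
    have h1 := ht.ofReal_exp_mul hγ (S.prepend a ω)
    rw [prepend_zero hω] at h1
    simp only [ratioProd]
    rw [shift_prepend hω, Real.mul_rpow (ht.ratio_pos hγ _).le (ht.ratioProd_pos hγ hpos n _).le,
      ENNReal.ofReal_mul (Real.rpow_nonneg (ht.ratio_pos hγ _).le _), ← mul_assoc, h1]

/-- The moment of order `-γ` of the length of `I_{ω₀}` is finite. -/
lemma IsGibbs.lintegral_halfLength_ne_top (hν : S.IsGibbs φ ν) (hφ : Continuous φ)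
    (hn : S.Normalized φ) (ht : S.LightTail φ γ) (hγ : 0 < γ) :
    ∫⁻ ω, ENNReal.ofReal (halfLength ω ^ (-γ)) ∂ν ≠ ∞ := by
  have := hν.1
  obtain ⟨B, hB⟩ := ht.exists_finset
  let k : A → ℝ≥0∞ := fun a => ENNReal.ofReal (((S.hi a - S.lo a) / 2) ^ (-γ))
  have hk : ∀ ω : S.Shift, ENNReal.ofReal (halfLength ω ^ (-γ)) = k (ω.1 0) := fun ω => rfl
  simp only [hk]
  have hkm : Measurable fun ω : S.Shift => k (ω.1 0) :=
    (Measurable.of_discrete (f := k)).comp (continuous_letter 0).measurable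
  let K : ℝ≥0∞ := ∑ a ∈ B, k a
  have hK : K ≠ ∞ := ENNReal.sum_ne_top.2 fun a _ => ENNReal.ofReal_ne_top
  -- Truncation at `T` makes the integral finite, as the absorption requires; the bound is uniform
  -- in `T`, so monotone convergence removes it.
  have hstep : ∀ T : ℕ, ∫⁻ ω, min (k (ω.1 0)) T ∂ν ≤ 2 * K := by
    intro T
    set X := ∫⁻ ω, min (k (ω.1 0)) T ∂ν with hX
    have hXT : X ≠ ∞ := by
      refine ne_top_of_le_ne_top (ENNReal.natCast_ne_top T) ?_
      calc X ≤ ∫⁻ _, (T : ℝ≥0∞) ∂ν := lintegral_mono fun ω => min_le_right _ _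
        _ = T := by simp
    obtain ⟨Y, hXY, hY1, hY2⟩ : ∃ Y : A → ℝ≥0∞, X = ∑' a, Y a ∧ (∀ a, Y a ≤ k a) ∧
        ∀ a, Y a ≤ S.tailSup φ γ a * X := by
      refine ⟨_, hν.lintegral_eq hφ hn (hkm.min (measurable_const (a := (T : ℝ≥0∞)))),
        fun a => ?_, fun a => ?_⟩
      · calc _ ≤ ∫⁻ _, k a ∂ν := by
              refine lintegral_indicator_le_of_le fun ω hω => ?_
              rw [prepend_zero hω]
              refine (mul_le_mul' (ENNReal.ofReal_le_one.2
                (Real.exp_le_one_iff.2 (hn.1 _).le)) (min_le_left _ _)).trans ?_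
              rw [one_mul]
          _ = k a := by simp
      · rw [hX, ← lintegral_const_mul _ (hkm.min measurable_const)]
        refine lintegral_indicator_le_of_le fun ω hω => ?_
        have h1 := ht.ofReal_exp_mul hγ (S.prepend a ω)
        have h2 := ht.ratio_mul_halfLength_le hγ (S.prepend a ω)
        have h3 := ht.one_le_ratio_rpow hγ (S.prepend a ω)
        have h4 : k ((S.prepend a ω).1 0) ≤
            ENNReal.ofReal (S.ratio φ γ (S.prepend a ω) ^ (-γ)) * k (ω.1 0) := by
          rw [← hk, ← hk, ← ENNReal.ofReal_mul (Real.rpow_nonneg (ht.ratio_pos hγ _).le _),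
            ← Real.mul_rpow (ht.ratio_pos hγ _).le (halfLength_pos _).le]
          rw [shift_prepend hω] at h2
          exact ENNReal.ofReal_le_ofReal (Real.rpow_le_rpow_of_nonpos
            (mul_pos (ht.ratio_pos hγ _) (halfLength_pos _)) h2 (by linarith))
        rw [prepend_zero hω] at h1
        rw [← h1, mul_assoc]
        refine mul_le_mul_right ?_ _
        -- The factor `ratio ^ (-γ)` is at least one, so the drift inequality survives truncation.
        rw [mul_min]
        exact min_le_min h4 (le_mul_of_one_le_left' h3)
    exact tsum_le_of_drift B hXT hXY hY1 hY2 hB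
  refine ne_top_of_le_ne_top (ENNReal.mul_ne_top (by simp) hK : 2 * K ≠ ∞) ?_
  have hsup : ∀ ω : S.Shift, k (ω.1 0) = ⨆ T : ℕ, min (k (ω.1 0)) (T : ℝ≥0∞) := by
    intro ω
    refine le_antisymm ?_ (iSup_le fun T => min_le_left _ _)
    obtain ⟨T, hT⟩ := ENNReal.exists_nat_gt (ENNReal.ofReal_ne_top : k (ω.1 0) ≠ ∞)
    exact le_iSup_of_le T (le_min le_rfl hT.le)
  rw [lintegral_congr hsup]
  rw [lintegral_iSup (fun T => hkm.min measurable_const)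
    (fun T T' h ω => min_le_min le_rfl (Nat.cast_le.2 h))]
  exact iSup_le hstep

/-- Markov's inequality for `IsGibbs.lintegral_ratioProd_le`. -/
lemma IsGibbs.measure_ratioProd_le (hν : S.IsGibbs φ ν) (hφ : Continuous φ)
    (hn : S.Normalized φ) (ht : S.LightTail φ γ) (hγ : 0 < γ) {h : S.Shift → ℝ}
    (hh : Measurable h) (hpos : ∀ ω, 0 < h ω) (n : ℕ) (r : ℝ≥0∞) :
    ν {ω | ENNReal.ofReal (S.ratioProd φ γ h n ω) ≤ r} ≤
      (∑' a, S.tailSup φ γ a) ^ n * (∫⁻ ω, ENNReal.ofReal (h ω ^ (-γ)) ∂ν) * r ^ γ := by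
  have hm := measurable_ratioProd (γ := γ) hφ hh n
  -- Markov's inequality at level one for the moment multiplied by `r ^ γ`, which avoids dividing by
  -- a possibly zero or infinite `r`.
  have h1 := mul_meas_ge_le_lintegral (μ := ν)
    (f := fun ω => ENNReal.ofReal (S.ratioProd φ γ h n ω ^ (-γ)) * r ^ γ) (by fun_prop) 1
  rw [one_mul, lintegral_mul_const _ (by fun_prop)] at h1
  refine le_trans (measure_mono fun ω hω => ?_)
    (h1.trans (mul_le_mul_left (hν.lintegral_ratioProd_le hφ hn ht hγ hh hpos n) _))
  have hp := ht.ratioProd_pos hγ hpos n ω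
  calc (1 : ℝ≥0∞) = ENNReal.ofReal (S.ratioProd φ γ h n ω ^ (-γ)) *
        ENNReal.ofReal (S.ratioProd φ γ h n ω) ^ γ := by
        rw [ENNReal.ofReal_rpow_of_pos hp, ← ENNReal.ofReal_mul (Real.rpow_nonneg hp.le _),
          ← Real.rpow_add hp, neg_add_cancel, Real.rpow_zero, ENNReal.ofReal_one]
    _ ≤ _ := mul_le_mul_right (ENNReal.rpow_le_rpow hω hγ.le) _

end Estimates

/-! ### Exponential decay of the measure of cylinders. -/

section Cylinders

variable {A : Type*} {S : MarkovIFS A} {φ : S.Shift → ℝ} {γ : ℝ}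

lemma iterate_shift_apply (k : ℕ) : ∀ (ω : S.Shift) (i : ℕ), (S.shift^[k] ω).1 i = ω.1 (i + k) := by
  induction k with
  | zero => exact fun ω i => rfl
  | succ k ih =>
    intro ω i
    rw [Function.iterate_succ_apply, ih]
    rfl

/-- The normalised potential is bounded away from zero along orbit segments of a fixed length. -/
lemma exists_birkhoffSum_le [TopologicalSpace A] [DiscreteTopology A] (hφ : Continuous φ)
    (hn : S.Normalized φ) (ht : S.LightTail φ γ) (hγ : 0 < γ) :
    ∃ N : ℕ, ∃ δ > 0, ∀ ω, birkhoffSum S.shift φ N ω ≤ -δ := by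
  by_contra! hcon
  choose ω hω using fun N : ℕ => hcon N (1 / ((N : ℝ) + 1)) (by positivity)
  -- All terms of the Birkhoff sum are negative, so each one exceeds the whole sum.
  have hsmall : ∀ N k : ℕ, k < N → -(1 / ((N : ℝ) + 1)) < φ (S.shift^[k] (ω N)) := by
    intro N k hk
    refine (hω N).trans_le ?_
    have h1 : birkhoffSum S.shift φ N (ω N) = ∑ j ∈ Finset.range N, φ (S.shift^[j] (ω N)) := rfl
    rw [h1, ← Finset.add_sum_erase _ _ (Finset.mem_range.2 hk)]
    have h2 : ∑ j ∈ (Finset.range N).erase k, φ (S.shift^[j] (ω N)) ≤ 0 :=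
      Finset.sum_nonpos fun j _ => (hn.1 _).le
    linarith
  obtain ⟨B, hB⟩ := ht.exists_finset
  have hU : (hyperfilter ℕ : Filter ℕ) ≤ atTop := by
    rw [← Nat.cofinite_eq_atTop]; exact hyperfilter_le_cofinite
  have hlim : Tendsto (fun N : ℕ => -(1 / ((N : ℝ) + 1))) atTop (𝓝 0) := by
    simpa using (tendsto_one_div_add_atTop_nhds_zero_nat (𝕜 := ℝ)).neg
  -- Compactness for a possibly infinite alphabet: `e ^ φ` is at most `1/2` on words starting
  -- outside `B`, so `φ` near zero confines letters to a finite set. Each coordinate is then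
  -- constant along the ultrafilter, and `φ` is nonnegative at the limit word.
  have hmem : ∀ k, ∀ᶠ N in (hyperfilter ℕ : Filter ℕ), ∃ a ∈ (B : Set A), (ω N).1 k = a := by
    intro k
    refine hU ?_
    have h2 : -Real.log 2 < 0 := neg_lt_zero.2 (Real.log_pos (by norm_num))
    filter_upwards [eventually_gt_atTop k, hlim.eventually_const_lt h2] with N hN hN'
    refine ⟨_, ?_, rfl⟩
    by_contra hb
    have h3 : S.tailSup φ γ ((ω N).1 k) ≤ 2⁻¹ :=
      (ENNReal.le_tsum (f := fun a : {a // a ∉ B} => S.tailSup φ γ a) ⟨(ω N).1 k, hb⟩).trans hB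
    have h4 := ht.exp_le hγ (S.shift^[k] (ω N))
    rw [iterate_shift_apply, zero_add] at h4
    have h5 : (S.tailSup φ γ ((ω N).1 k)).toReal ≤ 2⁻¹ := by
      simpa using ENNReal.toReal_mono (by simp) h3
    have h6 : Real.exp (-Real.log 2) < Real.exp (φ (S.shift^[k] (ω N))) :=
      Real.exp_lt_exp.2 (hN'.trans (hsmall N k hN))
    rw [Real.exp_neg, Real.exp_log (by norm_num)] at h6
    linarith
  have hlet : ∀ k, ∃ a, ∀ᶠ N in (hyperfilter ℕ : Filter ℕ), (ω N).1 k = a := by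
    intro k
    obtain ⟨a, -, ha⟩ := (Ultrafilter.eventually_exists_mem_iff B.finite_toSet).1 (hmem k)
    exact ⟨a, ha⟩
  choose w hw using hlet
  have hadm : ∀ k, S.adm (w k) (w (k + 1)) := by
    intro k
    obtain ⟨N, h1, h2⟩ := ((hw k).and (hw (k + 1))).exists
    rw [← h1, ← h2]
    exact (ω N).2 k
  have hconv : Tendsto ω (hyperfilter ℕ : Filter ℕ) (𝓝 ⟨w, hadm⟩) := by
    rw [tendsto_subtype_rng, tendsto_pi_nhds]
    intro k
    exact tendsto_const_nhds.congr' ((hw k).mono fun N h => h.symm)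
  have h0 : 0 ≤ φ ⟨w, hadm⟩ := by
    refine le_of_tendsto_of_tendsto (hlim.mono_left hU) ((hφ.tendsto _).comp hconv) (hU ?_)
    filter_upwards [eventually_gt_atTop 0] with N hN
    exact (hsmall N 0 hN).le
  exact (hn.1 _).not_ge h0

/-- The cylinder of length `n` of the sequence `w`. -/
def cylinder (S : MarkovIFS A) (n : ℕ) (w : ℕ → A) : Set S.Shift := {ω | ∀ i < n, ω.1 i = w i}

variable [Countable A] [TopologicalSpace A] [DiscreteTopology A]
  [MeasurableSpace A] [DiscreteMeasurableSpace A] {ν : Measure S.Shift}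

lemma measurable_birkhoffSum (hφ : Continuous φ) (n : ℕ) :
    Measurable (birkhoffSum S.shift φ n) := by
  have : birkhoffSum S.shift φ n = fun ω => ∑ k ∈ Finset.range n, φ (S.shift^[k] ω) := rfl
  rw [this]
  exact Finset.measurable_sum _ fun k _ =>
    hφ.measurable.comp (continuous_shift.measurable.iterate k)

lemma measurableSet_cylinder (n : ℕ) (w : ℕ → A) : MeasurableSet (S.cylinder n w) :=
  (isOpen_agree n w).measurableSet

/-- In one Gibbs step only the letter `w 0` contributes, and its weight `e ^ φ` cancels one term of
the Birkhoff sum. This gives the upper Gibbs bound without any distortion estimate for `φ`. -/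
lemma IsGibbs.lintegral_cylinder_le (hν : S.IsGibbs φ ν) (hφ : Continuous φ)
    (hn : S.Normalized φ) (n : ℕ) : ∀ w : ℕ → A,
    ∫⁻ ω, (S.cylinder n w).indicator
      (fun ω => ENNReal.ofReal (Real.exp (-birkhoffSum S.shift φ n ω))) ω ∂ν ≤ 1 := by
  have := hν.1
  induction n with
  | zero => intro w; simp [cylinder]
  | succ n ih =>
    intro w
    have hm := measurable_birkhoffSum (S := S) hφ (n + 1)
    rw [hν.lintegral_eq hφ hn (Measurable.indicator (by fun_prop) (measurableSet_cylinder _ _)),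
      tsum_eq_single (w 0)]
    · refine (lintegral_indicator_le_of_le fun ω hω => ?_).trans (ih fun k => w (k + 1))
      by_cases hc : S.prepend (w 0) ω ∈ S.cylinder (n + 1) w
      · have hc' : ω ∈ S.cylinder n fun k => w (k + 1) := by
          intro i hi
          have h1 := hc (i + 1) (by omega)
          conv_lhs => rw [← shift_prepend hω]
          exact h1
        rw [indicator_of_mem hc, indicator_of_mem hc', birkhoffSum_succ', shift_prepend hω,
          ← ENNReal.ofReal_mul (Real.exp_pos _).le, ← Real.exp_add]
        ring_nf
        exact le_rfl
      · rw [indicator_of_notMem hc, mul_zero]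
        exact zero_le
    · intro a ha
      rw [lintegral_eq_zero_iff (measurable_branch hφ a
        (Measurable.indicator (by fun_prop) (measurableSet_cylinder _ _)))]
      refine Eventually.of_forall fun ω => ?_
      by_cases hω : ω ∈ S.precedes a
      · rw [indicator_of_mem hω, indicator_of_notMem, mul_zero, Pi.zero_apply]
        intro hc
        exact ha ((prepend_zero hω).symm.trans (hc 0 (by omega)))
      · rw [indicator_of_notMem hω, Pi.zero_apply]

/-- Cylinders have exponentially small Gibbs measure. -/
lemma IsGibbs.exists_measure_cylinder_le (hν : S.IsGibbs φ ν) (hφ : Continuous φ)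
    (hn : S.Normalized φ) (ht : S.LightTail φ γ) (hγ : 0 < γ) :
    ∃ N : ℕ, ∃ θ : ℝ, 0 < θ ∧ θ < 1 ∧
      ∀ k w, ν (S.cylinder (N * k) w) ≤ ENNReal.ofReal θ ^ k := by
  obtain ⟨N, δ, hδ, hN⟩ := exists_birkhoffSum_le hφ hn ht hγ
  have hb : ∀ k ω, birkhoffSum S.shift φ (N * k) ω ≤ -(δ * k) := by
    intro k
    induction k with
    | zero => intro ω; simp
    | succ k ih =>
      intro ω
      rw [Nat.mul_succ, birkhoffSum_add]
      push_cast
      linarith [ih ω, hN (S.shift^[N * k] ω)]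
  refine ⟨N, Real.exp (-δ), Real.exp_pos _, Real.exp_lt_one_iff.2 (by linarith), fun k w => ?_⟩
  have h1 : ENNReal.ofReal (Real.exp (δ * k)) * ν (S.cylinder (N * k) w) ≤ 1 := by
    rw [← lintegral_indicator_const (measurableSet_cylinder _ _)]
    refine (lintegral_mono fun ω => ?_).trans (hν.lintegral_cylinder_le hφ hn (N * k) w)
    refine indicator_le_indicator (ENNReal.ofReal_le_ofReal (Real.exp_le_exp.2 ?_))
    linarith [hb k ω]
  have h2 : ENNReal.ofReal (Real.exp (-δ)) ^ k * ENNReal.ofReal (Real.exp (δ * k)) = 1 := by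
    rw [← ENNReal.ofReal_pow (Real.exp_pos _).le, ← ENNReal.ofReal_mul (by positivity),
      ← Real.exp_nat_mul, ← Real.exp_add]
    ring_nf
    simp
  calc ν (S.cylinder (N * k) w)
      = ENNReal.ofReal (Real.exp (-δ)) ^ k *
        (ENNReal.ofReal (Real.exp (δ * k)) * ν (S.cylinder (N * k) w)) := by
        rw [← mul_assoc, h2, one_mul]
    _ ≤ ENNReal.ofReal (Real.exp (-δ)) ^ k * 1 := mul_le_mul_right h1 _
    _ = _ := mul_one _

end Cylinders

/-! ### The case without overlaps. -/

section NoOverlaps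

variable {A : Type*} {S : MarkovIFS A} {φ : S.Shift → ℝ} {γ : ℝ}

/-- Disjointness determines the first letter `a` from the point; `T a` then undoes the branch
whatever the second letter is, and the argument repeats. -/
lemma NoOverlaps.eq_of_mem (hS : S.NoOverlaps) (n : ℕ) : ∀ (ω η : S.Shift) (x : ℝ),
    x ∈ S.wordInterval n ω.1 → x ∈ S.wordInterval n η.1 → ∀ i ≤ n, ω.1 i = η.1 i := by
  have hletter : ∀ (a b : A) (x : ℝ), x ∈ S.I a → x ∈ S.I b → a = b := fun a b x ha hb => by
    by_contra hab
    exact Set.disjoint_left.1 (hS hab) ha hb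
  induction n with
  | zero =>
    intro ω η x hx hy i hi
    obtain rfl : i = 0 := by omega
    exact hletter _ _ x hx hy
  | succ n ih =>
    intro ω η x hx hy
    have h0 : ω.1 0 = η.1 0 :=
      hletter _ _ x (S.wordInterval_subset _ ω hx) (S.wordInterval_subset _ η hy)
    obtain ⟨u, hu, rfl⟩ := hx
    obtain ⟨v, hv, hvu⟩ := hy
    have h1 := S.inverse_branch _ _ (ω.2 0) u (S.wordInterval_subset n (S.shift ω) hu)
    have h2 := S.inverse_branch _ _ (η.2 0) v (S.wordInterval_subset n (S.shift η) hv)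
    have huv : v = u := by rw [← h1, ← h2, hvu, h0]
    subst huv
    have h3 := ih (S.shift ω) (S.shift η) v hu hv
    intro i hi
    cases i with
    | zero => exact h0
    | succ i => exact h3 i (by omega)

/-- Two word intervals that adhere to `e` from the same side intersect. The two sides are the source
of the factor two in `NoOverlaps.measure_mem_closure_le`. -/
lemma _root_.Set.OrdConnected.exists_Ioo_subset_of_mem_closure {s : Set ℝ} (hs : s.OrdConnected)
    (hnt : s.Nontrivial) {e : ℝ} (he : e ∈ closure s) :
    (∃ δ > 0, Ioo e (e + δ) ⊆ s) ∨ ∃ δ > 0, Ioo (e - δ) e ⊆ s := by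
  obtain ⟨x, hx, hxe⟩ := hnt.exists_ne e
  rcases hxe.lt_or_gt with hlt | hlt
  · refine Or.inr ⟨e - x, by linarith, fun z hz => ?_⟩
    obtain ⟨y, hy, hys⟩ := mem_closure_iff.1 he (Ioi z) isOpen_Ioi hz.2
    exact hs.out hx hys ⟨by linarith [hz.1], le_of_lt hy⟩
  · refine Or.inl ⟨x - e, by linarith, fun z hz => ?_⟩
    obtain ⟨y, hy, hys⟩ := mem_closure_iff.1 he (Iio z) isOpen_Iio hz.1
    exact hs.out hys hx ⟨le_of_lt hy, by linarith [hz.2]⟩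

lemma measure_le_of_forall_agree [MeasurableSpace A] {ν : Measure S.Shift} {n : ℕ} {c : ℝ≥0∞}
    (hc : ∀ w, ν (S.cylinder n w) ≤ c) {s : Set S.Shift}
    (hs : ∀ ω ∈ s, ∀ η ∈ s, ∀ i < n, η.1 i = ω.1 i) : ν s ≤ c := by
  rcases s.eq_empty_or_nonempty with rfl | ⟨ω, hω⟩
  · simp
  · exact (measure_mono fun η hη => hs ω hω η hη).trans (hc ω.1)

/-- Without overlaps, at most two words of each length code the neighbourhood of a point. -/
lemma NoOverlaps.measure_mem_closure_le [MeasurableSpace A] (hS : S.NoOverlaps)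
    (ht : S.LightTail φ γ) (hγ : 0 < γ) {ν : Measure S.Shift} {n : ℕ} {c : ℝ≥0∞}
    (hc : ∀ w, ν (S.cylinder n w) ≤ c) (e : ℝ) :
    ν {ω | e ∈ closure (S.wordInterval n ω.1)} ≤ 2 * c := by
  have hsub : {ω : S.Shift | e ∈ closure (S.wordInterval n ω.1)} ⊆
      {ω | ∃ δ > 0, Ioo e (e + δ) ⊆ S.wordInterval n ω.1} ∪
      {ω | ∃ δ > 0, Ioo (e - δ) e ⊆ S.wordInterval n ω.1} := by
    intro ω hω
    refine (ordConnected_wordInterval n ω).exists_Ioo_subset_of_mem_closure ?_ hω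
    obtain ⟨x, hx, y, hy, hxy⟩ := ht.exists_ratioProd_le hγ n ω
    refine ⟨x, hx, y, hy, fun h => ?_⟩
    have := ht.ratioProd_pos hγ halfLength_pos n ω
    rw [h, sub_self, abs_zero] at hxy
    exact this.not_ge hxy
  rw [two_mul]
  refine (measure_mono hsub).trans ((measure_union_le _ _).trans (add_le_add ?_ ?_))
  -- `wordInterval n` involves `n + 1` letters while `cylinder n` fixes only `n`, so the agreement
  -- obtained is more than enough.
  · refine measure_le_of_forall_agree hc ?_
    rintro ω ⟨δ, hδ, h1⟩ η ⟨δ', hδ', h2⟩ i hi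
    refine hS.eq_of_mem n η ω (e + min δ δ' / 2) (h2 ?_) (h1 ?_) i hi.le <;>
    · have := lt_min hδ hδ'
      constructor <;> linarith [min_le_left δ δ', min_le_right δ δ']
  · refine measure_le_of_forall_agree hc ?_
    rintro ω ⟨δ, hδ, h1⟩ η ⟨δ', hδ', h2⟩ i hi
    refine hS.eq_of_mem n η ω (e - min δ δ' / 2) (h2 ?_) (h1 ?_) i hi.le <;>
    · have := lt_min hδ hδ'
      constructor <;> linarith [min_le_left δ δ', min_le_right δ δ']

lemma _root_.Set.OrdConnected.ofReal_abs_sub_le_volume {J : Set ℝ} (hJ : J.OrdConnected) {x y : ℝ}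
    (hx : x ∈ J) (hy : y ∈ J) : ENNReal.ofReal |x - y| ≤ volume J := by
  rw [abs_sub_comm, ← Real.volume_interval]
  exact measure_mono (hJ.uIcc_subset hx hy)

lemma _root_.Set.OrdConnected.mem_closure_of_mem_Icc {s : Set ℝ} (hs : s.OrdConnected) {x y z : ℝ}
    (hx : x ∈ closure s) (hy : y ∈ closure s) (hz : z ∈ Icc x y) : z ∈ closure s :=
  hs.isPreconnected.closure.ordConnected.out hx hy hz

/-- The basic estimate for the projected Gibbs measure without overlaps. -/
lemma NoOverlaps.exists_measure_le [Countable A] [TopologicalSpace A] [DiscreteTopology A]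
    [MeasurableSpace A] [DiscreteMeasurableSpace A] {ν : Measure S.Shift} (hS : S.NoOverlaps)
    (hν : S.IsGibbs φ ν) (hφ : Continuous φ) (hn : S.Normalized φ) (ht : S.LightTail φ γ)
    (hγ : 0 < γ) :
    ∃ K Z L : ℝ≥0∞, K ≠ ∞ ∧ Z ≠ ∞ ∧ L ≠ ∞ ∧ ∃ θ : ℝ, 0 < θ ∧ θ < 1 ∧
      ∀ J : Set ℝ, J.OrdConnected → ∀ k : ℕ,
        ν (S.coding ⁻¹' J) ≤ K * ENNReal.ofReal θ ^ k + Z * L ^ k * volume J ^ γ := by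
  obtain ⟨N, θ, hθ0, hθ1, hθ⟩ := hν.exists_measure_cylinder_le hφ hn ht hγ
  -- The constant 4 counts two endpoints of `J` with two words each.
  refine ⟨4, ∫⁻ ω, ENNReal.ofReal (halfLength ω ^ (-γ)) ∂ν, (∑' a, S.tailSup φ γ a) ^ N, by simp,
    hν.lintegral_halfLength_ne_top hφ hn ht hγ, ENNReal.pow_ne_top ht.tsum_ne_top,
    θ, hθ0, hθ1, fun J hJ k => ?_⟩
  have hsub : S.coding ⁻¹' J ⊆ ({ω | sInf J ∈ closure (S.wordInterval (N * k) ω.1)} ∪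
      {ω | sSup J ∈ closure (S.wordInterval (N * k) ω.1)}) ∪
      {ω | ENNReal.ofReal (S.ratioProd φ γ halfLength (N * k) ω) ≤ volume J} := by
    intro ω hω
    have hπ := coding_mem ω (N * k)
    have hoc := ordConnected_wordInterval (N * k) ω
    by_cases hI : S.wordInterval (N * k) ω.1 ⊆ J
    · right
      obtain ⟨x, hx, y, hy, hxy⟩ := ht.exists_ratioProd_le hγ (N * k) ω
      exact (ENNReal.ofReal_le_ofReal hxy).trans (hJ.ofReal_abs_sub_le_volume (hI hx) (hI hy))
    · left
      -- A point `p` of the word interval outside `J` bounds `J` on one side. The end of `J` on that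
      -- side is then a genuine infimum or supremum and lies between `p` and `π(ω)`.
      obtain ⟨p, hp, hpJ⟩ := Set.not_subset.1 hI
      rcases le_total p (S.coding ω) with hle | hle
      · left
        have hlow : p ∈ lowerBounds J := fun z hz => by
          by_contra! hzp
          exact hpJ (hJ.out hz hω ⟨hzp.le, hle⟩)
        exact hoc.mem_closure_of_mem_Icc (subset_closure hp) hπ
          ⟨le_csInf ⟨_, hω⟩ hlow, csInf_le ⟨p, hlow⟩ hω⟩
      · right
        have hup : p ∈ upperBounds J := fun z hz => by
          by_contra! hzp
          exact hpJ (hJ.out hω hz ⟨hle, hzp.le⟩)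
        exact hoc.mem_closure_of_mem_Icc hπ (subset_closure hp)
          ⟨le_csSup ⟨p, hup⟩ hω, csSup_le ⟨_, hω⟩ hup⟩
  refine (measure_mono hsub).trans ((measure_union_le _ _).trans (add_le_add ?_ ?_))
  · refine (measure_union_le _ _).trans ?_
    calc _ ≤ 2 * ENNReal.ofReal θ ^ k + 2 * ENNReal.ofReal θ ^ k :=
          add_le_add (hS.measure_mem_closure_le ht hγ (hθ k) _)
            (hS.measure_mem_closure_le ht hγ (hθ k) _)
      _ = 4 * ENNReal.ofReal θ ^ k := by rw [← add_mul]; norm_num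
  · rw [mul_comm (∫⁻ ω, _ ∂ν), ← pow_mul]
    exact hν.measure_ratioProd_le hφ hn ht hγ measurable_halfLength halfLength_pos _ _

end NoOverlaps

/-! ### Full shifts: separated words from a nontrivial attractor. -/

section FullShift

variable {A : Type*} {S : MarkovIFS A} {φ : S.Shift → ℝ} {γ : ℝ}

/-- The constant word `aaa…` of a full shift. -/
def constWord (hfull : ∀ a b, S.adm a b) (a : A) : S.Shift := ⟨fun _ => a, fun _ => hfull a a⟩

/-- The images of two branches of `T_a` that accumulate at the same point near the fixed point of
`g_{aa}` overlap there. -/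
lemma eventually_mem_image (hfull : ∀ a b, S.adm a b) (a b : A) {x z : ℕ → ℝ} {y : ℝ}
    (hx : ∀ n, x n ∈ S.I a) (hz : ∀ n, z n ∈ S.I b)
    (hxy : Tendsto x atTop (𝓝 y)) (hgx : Tendsto (fun n => S.g a a (x n)) atTop (𝓝 y))
    (hgz : Tendsto (fun n => S.g a b (z n)) atTop (𝓝 y)) :
    ∀ᶠ n in atTop, S.g a b (z n) ∈ S.g a a '' S.I a := by
  have hcd := S.contDiffOn a a (hfull a a)
  have hoc : (S.g a a '' S.I a).OrdConnected :=
    ((isPreconnected_Ioo).image _ hcd.continuousOn).ordConnected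
  have hgzI : ∀ n, S.g a b (z n) ∈ Ioo (S.lo a) (S.hi a) := fun n =>
    S.mapsTo a b (hfull a b) (hz n)
  have hgxI : ∀ n, S.g a a (x n) ∈ Ioo (S.lo a) (S.hi a) := fun n =>
    S.mapsTo a a (hfull a a) (hx n)
  -- At an interior point, `y` is fixed by `g a a`, which is open there because its derivative is
  -- nonzero. At an endpoint both image sequences approach from inside `I_a`, and the image of `g a
  -- a` is an interval accumulating at `y`.
  by_cases hy : y ∈ S.I a
  · have hcda : ContDiffAt ℝ 1 (S.g a a) y := hcd.contDiffAt (isOpen_Ioo.mem_nhds hy)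
    have hfix : S.g a a y = y :=
      tendsto_nhds_unique (hcda.continuousAt.tendsto.comp hxy) hgx
    have hmap := (hcda.hasStrictDerivAt (by simp)).map_nhds_eq
      (abs_pos.1 (deriv_pos (hfull a a) hy).1)
    rw [hfix] at hmap
    refine hgz.eventually_mem ?_
    rw [← hmap]
    exact image_mem_map (isOpen_Ioo.mem_nhds hy)
  · have hyc : y ∈ Icc (S.lo a) (S.hi a) :=
      isClosed_Icc.mem_of_tendsto hxy (Eventually.of_forall fun n => Ioo_subset_Icc_self (hx n))
    rcases hyc.1.eq_or_lt with hlo | hlo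
    · filter_upwards [hgz.eventually_lt_const (hlo ▸ (hgxI 0).1 : y < S.g a a (x 0))] with n hn
      obtain ⟨m, hm⟩ :=
        (hgx.eventually_lt_const (hlo ▸ (hgzI n).1 : y < S.g a b (z n))).exists
      exact hoc.out (mem_image_of_mem _ (hx m)) (mem_image_of_mem _ (hx 0)) ⟨hm.le, hn.le⟩
    · have hhi : y = S.hi a := hyc.2.eq_of_not_lt fun h => hy ⟨hlo, h⟩
      filter_upwards [hgz.eventually_const_lt (hhi ▸ (hgxI 0).2 : S.g a a (x 0) < y)] with n hn
      obtain ⟨m, hm⟩ :=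
        (hgx.eventually_const_lt (hhi ▸ (hgzI n).2 : S.g a b (z n) < y)).exists
      exact hoc.out (mem_image_of_mem _ (hx 0)) (mem_image_of_mem _ (hx m)) ⟨hn.le, hm.le⟩

/-- If the code depended on the first letter only, `abbb…` and `aaa…` would code the same point.
Near it the images of `g a b` and `g a a` overlap, and `T a` inverts both, so their preimages there
also converge to a common point. -/
lemma coding_constWord_eq (hfull : ∀ a b, S.adm a b)
    (hconst : ∀ ω η : S.Shift, ω.1 0 = η.1 0 → S.coding ω = S.coding η) (a b : A) :
    S.coding (constWord hfull a) = S.coding (constWord hfull b) := by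
  choose x hx using fun n => S.wordInterval_nonempty n (constWord hfull a).1
  choose z hz using fun n => S.wordInterval_nonempty n (constWord hfull b).1
  have hxI : ∀ n, x n ∈ S.I a := fun n => S.wordInterval_subset n (constWord hfull a) (hx n)
  have hzI : ∀ n, z n ∈ S.I b := fun n => S.wordInterval_subset n (constWord hfull b) (hz n)
  have hxt := tendsto_coding _ hx
  have hzt := tendsto_coding _ hz
  have hgx : Tendsto (fun n => S.g a a (x n)) atTop (𝓝 (S.coding (constWord hfull a))) :=
    tendsto_g_coding (constWord hfull a) hx
  have hgz : Tendsto (fun n => S.g a b (z n)) atTop (𝓝 (S.coding (constWord hfull a))) := by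
    have h1 := tendsto_g_coding (S.cons a (constWord hfull b) (hfull _ _)) hz
    rwa [hconst (S.cons a (constWord hfull b) (hfull _ _)) (constWord hfull a) rfl] at h1
  have hev := eventually_mem_image hfull a b hxI hzI hxt hgx hgz
  obtain ⟨m, hm, -, hd⟩ := S.contraction a a (hfull a a)
  have hle : ∀ᶠ n in atTop, m * |z n - x n| ≤ |S.g a b (z n) - S.g a a (x n)| := by
    filter_upwards [hev] with n hn
    obtain ⟨t, ht, htz⟩ := hn
    have h1 := S.inverse_branch a a (hfull a a) t ht
    have h2 := S.inverse_branch a b (hfull a b) (z n) (hzI n)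
    have h3 : t = z n := by rw [← h1, ← h2, htz]
    subst h3
    obtain ⟨s, hs, h4⟩ := exists_deriv_eq_slope_of_mem (hfull a a) ht (hxI n)
    rw [← htz, h4]
    exact mul_le_mul_of_nonneg_right (hd s hs).1 (abs_nonneg _)
  have hlim := le_of_tendsto_of_tendsto ((hzt.sub hxt).abs.const_mul m) (hgz.sub hgx).abs hle
  rw [sub_self, abs_zero] at hlim
  have h0 : |S.coding (constWord hfull b) - S.coding (constWord hfull a)| = 0 :=
    le_antisymm (nonpos_of_mul_nonpos_right hlim hm) (abs_nonneg _)
  exact (sub_eq_zero.1 (abs_eq_zero.1 h0)).symm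

/-- If the attractor of a full shift is not a point, the coding is not constant on some cylinder
of length one. -/
lemma exists_coding_ne (hfull : ∀ a b, S.adm a b) (hF : S.attractor.Nontrivial) :
    ∃ ω η : S.Shift, ω.1 0 = η.1 0 ∧ S.coding ω ≠ S.coding η := by
  by_contra! hconst
  have hall : ∀ ω η : S.Shift, S.coding ω = S.coding η := by
    intro ω η
    rw [hconst ω (constWord hfull (ω.1 0)) rfl, hconst η (constWord hfull (η.1 0)) rfl]
    exact coding_constWord_eq hfull hconst _ _
  have hword : ∀ x ∈ S.attractor, ∀ n, ∃ ω : S.Shift, |x - S.coding ω| ≤ S.κ ^ n := by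
    intro x hx n
    obtain ⟨w, -, hw⟩ := mem_iUnion₂.1 (mem_iInter.1 hx n)
    exact ⟨⟨w, fun _ => hfull _ _⟩, abs_sub_le_of_mem_closure n ⟨w, fun _ => hfull _ _⟩ hw
      (coding_mem _ n)⟩
  obtain ⟨x, hx, y, hy, hxy⟩ := hF
  obtain ⟨ω, -⟩ := hword x hx 0
  have heq : ∀ z ∈ S.attractor, z = S.coding ω := by
    intro z hz
    refine sub_eq_zero.1 (abs_eq_zero.1 (le_antisymm ?_ (abs_nonneg _)))
    refine ge_of_tendsto' (tendsto_pow_kappa (S := S)) fun n => ?_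
    obtain ⟨η, hη⟩ := hword z hz n
    rwa [hall ω η]
  exact hxy ((heq x hx).trans (heq y hy).symm)

/-- The word `u₀…uₙω`. -/
noncomputable def prependList (S : MarkovIFS A) (u : List A) (ω : S.Shift) : S.Shift :=
  u.foldr S.prepend ω

lemma prependList_cons (a : A) (u : List A) (ω : S.Shift) :
    S.prependList (a :: u) ω = S.prepend a (S.prependList u ω) := rfl

lemma prependList_append (u v : List A) (ω : S.Shift) :
    S.prependList (u ++ v) ω = S.prependList u (S.prependList v ω) := List.foldr_append

lemma prepend_succ (hfull : ∀ a b, S.adm a b) (a : A) (ω : S.Shift) (i : ℕ) :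
    (S.prepend a ω).1 (i + 1) = ω.1 i :=
  congrFun (congrArg Subtype.val (shift_prepend (a := a) (ω := ω) (hfull _ _))) i

lemma prependList_apply (hfull : ∀ a b, S.adm a b) (u : List A) (ω : S.Shift) :
    ∀ (i : ℕ) (hi : i < u.length), (S.prependList u ω).1 i = u[i] := by
  induction u with
  | nil => intro i hi; simp at hi
  | cons a u ih =>
    intro i hi
    rw [prependList_cons]
    cases i with
    | zero => exact prepend_zero (hfull _ _)
    | succ i => rw [prepend_succ hfull]; exact ih i (by simpa using hi)

/-- The common first letter ensures that the same branches act on both words. The contraction bound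
can be read off `ω` alone, since `ratio` bounds the derivative on the whole interval. -/
lemma LightTail.ratioProd_le_abs_coding_sub (ht : S.LightTail φ γ) (hγ : 0 < γ)
    (hfull : ∀ a b, S.adm a b) {δ : ℝ} {ω η : S.Shift} (h0 : ω.1 0 = η.1 0)
    (hδ : δ ≤ |S.coding ω - S.coding η|) (u : List A) :
    (S.prependList u ω).1 0 = (S.prependList u η).1 0 ∧
    S.ratioProd φ γ (fun _ => δ) u.length (S.prependList u ω) ≤
      |S.coding (S.prependList u ω) - S.coding (S.prependList u η)| := by
  induction u with
  | nil => exact ⟨h0, hδ⟩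
  | cons a u ih =>
    have h1 : ∀ ζ : S.Shift, ζ ∈ S.precedes a := fun ζ => hfull _ _
    have h2 : (S.prependList (a :: u) ω).1 0 = (S.prependList (a :: u) η).1 0 := by
      rw [prependList_cons, prependList_cons, prepend_zero (h1 _), prepend_zero (h1 _)]
    refine ⟨h2, ?_⟩
    have h3 := ht.ratio_mul_coding_le hγ (S.prependList (a :: u) ω) (S.prependList (a :: u) η) h2
      (by rw [prependList_cons, prependList_cons, prepend_succ hfull, prepend_succ hfull]
          exact ih.1)
    refine le_trans ?_ h3
    rw [List.length_cons, ratioProd, prependList_cons, prependList_cons, shift_prepend (h1 _),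
      shift_prepend (h1 _)]
    exact mul_le_mul_of_nonneg_left ih.2 (ht.ratio_pos hγ _).le

lemma LightTail.antitone_ratioProd (ht : S.LightTail φ γ) (hγ : 0 < γ) {δ : ℝ} (hδ : 0 < δ)
    (ω : S.Shift) : Antitone fun n => S.ratioProd φ γ (fun _ => δ) n ω := by
  refine antitone_nat_of_succ_le fun n => ?_
  induction n generalizing ω with
  | zero => exact mul_le_of_le_one_left hδ.le (ht.ratio_le_one hγ ω)
  | succ n ih => exact mul_le_mul_of_nonneg_left (ih (S.shift ω)) (ht.ratio_pos hγ ω).le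

/-- Long prefixes of two words with different codes determine the codes up to a quarter of the
distance each, so half of it persists for all continuations. -/
lemma exists_separated_words (hfull : ∀ a b, S.adm a b) (hF : S.attractor.Nontrivial) :
    ∃ v v' : List A, v.length = v'.length ∧ ∃ δ > 0, ∀ ζ ζ' : S.Shift,
      (S.prependList v ζ).1 0 = (S.prependList v' ζ').1 0 ∧
      δ ≤ |S.coding (S.prependList v ζ) - S.coding (S.prependList v' ζ')| := by
  obtain ⟨ω, η, h0, hne⟩ := exists_coding_ne hfull hF
  have hd : 0 < |S.coding ω - S.coding η| := abs_pos.2 (sub_ne_zero.2 hne)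
  obtain ⟨n, hn⟩ :=
    ((tendsto_pow_kappa (S := S)).eventually_lt_const (show 0 < |S.coding ω - S.coding η| / 4 by
      positivity)).exists
  have hpre : ∀ (w ζ : S.Shift), ∀ i ≤ n,
      (S.prependList (List.ofFn fun i : Fin (n + 1) => w.1 i) ζ).1 i = w.1 i := by
    intro w ζ i hi
    rw [prependList_apply hfull _ ζ i (by simpa using Nat.lt_succ_of_le hi),
      List.getElem_ofFn]
  refine ⟨List.ofFn fun i : Fin (n + 1) => ω.1 i, List.ofFn fun i : Fin (n + 1) => η.1 i,
    by simp, |S.coding ω - S.coding η| / 2, by positivity, fun ζ ζ' => ⟨?_, ?_⟩⟩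
  · rw [hpre ω ζ 0 (Nat.zero_le _), hpre η ζ' 0 (Nat.zero_le _), h0]
  · set ω' := S.prependList (List.ofFn fun i : Fin (n + 1) => ω.1 i) ζ
    set η' := S.prependList (List.ofFn fun i : Fin (n + 1) => η.1 i) ζ'
    have h1 := abs_coding_sub_le n ω' ω (hpre ω ζ)
    have h2 := abs_coding_sub_le n η' η (hpre η ζ')
    have h3 : |S.coding ω - S.coding η| ≤ |S.coding ω' - S.coding ω| +
        |S.coding ω' - S.coding η'| + |S.coding η' - S.coding η| := by
      have := abs_add_three (S.coding ω - S.coding ω') (S.coding ω' - S.coding η')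
        (S.coding η' - S.coding η)
      rw [abs_sub_comm (S.coding ω) (S.coding ω')] at this
      refine le_trans (le_of_eq ?_) this
      congr 1; ring
    linarith

end FullShift

/-! ### The case of Bernoulli weights. -/

section Bernoulli

variable {A : Type*} {S : MarkovIFS A} {φ : S.Shift → ℝ} {γ : ℝ}

/-- With Bernoulli weights the normalisation forces all pairs to be admissible. -/
lemma Normalized.adm_of_isBernoulli (hn : S.Normalized φ) (hB : S.IsBernoulli φ) (ω₀ : S.Shift) :
    ∀ a b, S.adm a b := by
  classical
  obtain ⟨p, hp, hsum, hφp⟩ := hB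
  have key : ∀ (ω : S.Shift) (a : A), S.adm a (ω.1 0) := by
    intro ω
    -- Both `p` and the branch weights sum to one, and the latter are `p a` or zero. Their
    -- nonnegative differences sum to zero, so no branch is missing.
    have h1 := hsum.sub (hn.2 ω)
    rw [sub_self, hasSum_zero_iff_of_nonneg] at h1
    · intro a
      by_contra ha
      have h2 := congrFun h1 a
      simp only [branchTerm, dif_neg ha, sub_zero, Pi.zero_apply] at h2
      exact (hp a).ne' h2
    · intro a
      simp only [branchTerm]
      split_ifs with h
      · rw [hφp, mul_one]
        exact (sub_self (p a)).ge
      · simpa using (hp a).le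
  exact fun a b => key (S.cons b ω₀ (key ω₀ b)) a

variable [Countable A] [TopologicalSpace A] [DiscreteTopology A]
  [MeasurableSpace A] [DiscreteMeasurableSpace A] {ν : Measure S.Shift}

lemma measurable_prependList (u : List A) : Measurable (S.prependList u) := by
  induction u with
  | nil => exact measurable_id
  | cons a u ih => exact (continuous_prepend a).measurable.comp ih

lemma IsGibbs.measure_eq_tsum (hν : S.IsGibbs φ ν) (hφ : Continuous φ) (hn : S.Normalized φ)
    (hfull : ∀ a b, S.adm a b) {p : A → ℝ} (hp : ∀ ω : S.Shift, Real.exp (φ ω) = p (ω.1 0))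
    {G : Set S.Shift} (hG : MeasurableSet G) :
    ν G = ∑' a, ENNReal.ofReal (p a) * ν (S.prepend a ⁻¹' G) := by
  rw [← lintegral_indicator_one hG, hν.lintegral_eq hφ hn (measurable_one.indicator hG)]
  refine tsum_congr fun a => ?_
  have hG' : MeasurableSet (S.prepend a ⁻¹' G) := (continuous_prepend a).measurable hG
  rw [← lintegral_indicator_one hG', ← lintegral_const_mul _ (measurable_one.indicator hG')]
  refine lintegral_congr fun ω => ?_
  have hω : ω ∈ S.precedes a := hfull _ _
  rw [indicator_of_mem hω, hp, prepend_zero hω]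
  rfl

variable {p : A → ℝ}

/-- The weights do not depend on the continuation, so `ν G` is an average of the measures of the
pullbacks under words of length `n`. -/
lemma IsGibbs.measure_le_of_prependList (hν : S.IsGibbs φ ν) (hφ : Continuous φ)
    (hn : S.Normalized φ) (hfull : ∀ a b, S.adm a b)
    (hp : ∀ ω : S.Shift, Real.exp (φ ω) = p (ω.1 0)) (hsum : ∑' a, ENNReal.ofReal (p a) = 1)
    {β : ℝ≥0∞} (n : ℕ) : ∀ {G : Set S.Shift}, MeasurableSet G →
    (∀ w : List A, w.length = n → ν (S.prependList w ⁻¹' G) ≤ β) → ν G ≤ β := by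
  induction n with
  | zero => exact fun _ h => h [] rfl
  | succ n ih =>
    intro G hG h
    rw [hν.measure_eq_tsum hφ hn hfull hp hG]
    calc _ ≤ ∑' a, ENNReal.ofReal (p a) * β := by
          refine ENNReal.tsum_le_tsum fun a => mul_le_mul_right ?_ _
          exact ih ((continuous_prepend a).measurable hG) fun w hw => h (a :: w) (by simp [hw])
      _ = β := by rw [ENNReal.tsum_mul_right, hsum, one_mul]

/-- If `G` avoids the cylinder of `v`, it loses the proportion of mass that `v` carries. -/
lemma IsGibbs.measure_add_le_of_prependList (hν : S.IsGibbs φ ν) (hφ : Continuous φ)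
    (hn : S.Normalized φ) (hfull : ∀ a b, S.adm a b)
    (hp : ∀ ω : S.Shift, Real.exp (φ ω) = p (ω.1 0)) (hsum : ∑' a, ENNReal.ofReal (p a) = 1)
    {β : ℝ≥0∞} (v : List A) : ∀ {G : Set S.Shift}, MeasurableSet G →
    (∀ w : List A, w.length = v.length → ν (S.prependList w ⁻¹' G) ≤ β) →
    S.prependList v ⁻¹' G = ∅ →
    ν G + (v.map fun a => ENNReal.ofReal (p a)).prod * β ≤ β := by
  classical
  induction v with
  | nil =>
    intro G _ _ h
    have : G = ∅ := h
    simp [this]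
  | cons c v ih =>
    intro G hG h hv
    have hG' : ∀ a, MeasurableSet (S.prepend a ⁻¹' G) := fun a =>
      (continuous_prepend a).measurable hG
    -- The deficit is written as a sum over letters supported at `c`, for a termwise comparison.
    rw [hν.measure_eq_tsum hφ hn hfull hp hG, List.map_cons, List.prod_cons, mul_assoc,
      ← tsum_ite_eq c (fun a => ENNReal.ofReal (p a) *
        ((v.map fun a => ENNReal.ofReal (p a)).prod * β)), ← ENNReal.tsum_add]
    calc _ ≤ ∑' a, ENNReal.ofReal (p a) * β := by
          refine ENNReal.tsum_le_tsum fun a => ?_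
          split_ifs with hac
          · subst hac
            rw [← mul_add]
            exact mul_le_mul_right (ih (hG' _) (fun w hw => h (_ :: w) (by simp [hw])) hv) _
          · rw [add_zero]
            refine mul_le_mul_right (hν.measure_le_of_prependList hφ hn hfull hp hsum v.length
              (hG' a) fun w hw => h (a :: w) (by simp [hw])) _
      _ = β := by rw [ENNReal.tsum_mul_right, hsum, one_mul]

/-- The basic estimate for the projected Gibbs measure with Bernoulli weights. -/
lemma IsBernoulli.exists_measure_le (hB : S.IsBernoulli φ) (hF : S.attractor.Nontrivial)
    (hν : S.IsGibbs φ ν) (hφ : Continuous φ) (hn : S.Normalized φ) (ht : S.LightTail φ γ)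
    (hγ : 0 < γ) :
    ∃ K Z L : ℝ≥0∞, K ≠ ∞ ∧ Z ≠ ∞ ∧ L ≠ ∞ ∧ ∃ θ : ℝ, 0 < θ ∧ θ < 1 ∧
      ∀ J : Set ℝ, J.OrdConnected → ∀ k : ℕ,
        ν (S.coding ⁻¹' J) ≤ K * ENNReal.ofReal θ ^ k + Z * L ^ k * volume J ^ γ := by
  have := hν.1
  obtain ⟨ω₀⟩ : Nonempty S.Shift := nonempty_of_isProbabilityMeasure ν
  have hfull := hn.adm_of_isBernoulli hB ω₀
  obtain ⟨p, hp0, hp1, hp⟩ := hB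
  have hsum : ∑' a, ENNReal.ofReal (p a) = 1 := by
    rw [← ENNReal.ofReal_tsum_of_nonneg (fun a => (hp0 a).le) hp1.summable, hp1.tsum_eq,
      ENNReal.ofReal_one]
  obtain ⟨v, v', hlen, δ, hδ, hsep⟩ := exists_separated_words hfull hF
  let P : List A → ℝ≥0∞ := fun v => (v.map fun a => ENNReal.ofReal (p a)).prod
  have hP : ∀ v, P v ≠ 0 := by
    intro v
    refine List.prod_ne_zero fun h0 => ?_
    obtain ⟨a, -, ha⟩ := List.mem_map.1 h0
    exact (ENNReal.ofReal_pos.2 (hp0 a)).ne' ha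
  have hmin : min (P v) (P v') ≠ 0 := by
    rcases min_choice (P v) (P v') with h | h <;> rw [h] <;> exact hP _
  -- A proportion of at least `min (P v) (P v')` is lost per block; the maximum with `1/2` keeps `θ`
  -- positive.
  set θ : ℝ := max (1 - min (P v) (P v')).toReal 2⁻¹ with hθ
  have hθ1 : θ < 1 := by
    refine max_lt ?_ (by norm_num)
    have : (1 : ℝ≥0∞) - min (P v) (P v') < 1 := ENNReal.sub_lt_self (by simp) (by simp) hmin
    simpa using (ENNReal.toReal_lt_toReal this.ne_top ENNReal.one_ne_top).2 this
  have hθle : 1 - min (P v) (P v') ≤ ENNReal.ofReal θ := by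
    rw [← ENNReal.ofReal_toReal (ENNReal.sub_ne_top ENNReal.one_ne_top :
      1 - min (P v) (P v') ≠ ∞)]
    exact ENNReal.ofReal_le_ofReal (le_max_left _ _)
  refine ⟨1, ENNReal.ofReal (δ ^ (-γ)), (∑' a, S.tailSup φ γ a) ^ v.length, by simp,
    ENNReal.ofReal_ne_top, ENNReal.pow_ne_top ht.tsum_ne_top, θ,
    lt_max_of_lt_right (by norm_num), hθ1, fun J hJ k => ?_⟩
  have hmeas : ∀ (u : List A) (m : ℕ), MeasurableSet {ω | S.coding (S.prependList u ω) ∈ J ∧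
      volume J < ENNReal.ofReal (S.ratioProd φ γ (fun _ => δ) m (S.prependList u ω))} := by
    intro u m
    have h1 := measurable_prependList (S := S) u
    have h2 := measurable_ratioProd (S := S) (γ := γ) hφ (measurable_const (a := δ)) m
    have h3 := (continuous_coding (S := S)).measurable
    exact ((h3.comp h1) hJ.measurableSet).inter
      (measurableSet_lt measurable_const (h2.comp h1).ennreal_ofReal)
  -- The prefix `u` is arbitrary because pulling back by a block `w` replaces `u` by `u ++ w`.
  have claim : ∀ (n : ℕ) (u : List A), ν {ω | S.coding (S.prependList u ω) ∈ J ∧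
      volume J < ENNReal.ofReal (S.ratioProd φ γ (fun _ => δ) (u.length + v.length * n)
        (S.prependList u ω))} ≤ ENNReal.ofReal θ ^ n := by
    intro n
    induction n with
    | zero => intro u; simpa using prob_le_one
    | succ n ih =>
      intro u
      set G : Set S.Shift := {ω | S.coding (S.prependList u ω) ∈ J ∧
        volume J < ENNReal.ofReal (S.ratioProd φ γ (fun _ => δ) (u.length + v.length * (n + 1))
          (S.prependList u ω))} with hG
      have hpre : ∀ w : List A, w.length = v.length →
          ν (S.prependList w ⁻¹' G) ≤ ENNReal.ofReal θ ^ n := by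
        intro w hw
        refine le_trans (le_of_eq ?_) (ih (u ++ w))
        congr 1
        ext ω
        simp only [hG, mem_preimage, mem_ofPred_eq, ← prependList_append, List.length_append, hw]
        rw [show u.length + v.length * (n + 1) = u.length + v.length + v.length * n by ring]
      -- Otherwise `J` would contain codes under `uv` and `uv'`, whose distance is at least the
      -- contracted gap. The product over the longer word is smaller still, yet exceeds `|J|`.
      have hempty : ∃ w ∈ ({v, v'} : Set (List A)), S.prependList w ⁻¹' G = ∅ := by
        by_contra! hcon
        obtain ⟨ζ, hζ⟩ := hcon v (by simp)
        obtain ⟨ζ', hζ'⟩ := hcon v' (by simp)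
        obtain ⟨hs0, hs1⟩ := hsep ζ ζ'
        have h1 := (ht.ratioProd_le_abs_coding_sub hγ hfull hs0 hs1 u).2
        have h2 := hJ.ofReal_abs_sub_le_volume hζ.1 hζ'.1
        have h3 := ht.antitone_ratioProd hγ hδ (S.prependList u (S.prependList v ζ))
          (Nat.le_add_right u.length (v.length * (n + 1)))
        exact (h2.trans_lt hζ.2).not_ge (ENNReal.ofReal_le_ofReal (h3.trans h1))
      obtain ⟨w, hw, hw0⟩ := hempty
      have hwP : min (P v) (P v') ≤ P w ∧ w.length = v.length := by
        rcases hw with rfl | rfl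
        · exact ⟨min_le_left _ _, rfl⟩
        · exact ⟨min_le_right _ _, hlen.symm⟩
      have hadd := hν.measure_add_le_of_prependList hφ hn hfull hp hsum (β := ENNReal.ofReal θ ^ n)
        w (hmeas u _) (fun z hz => hpre z (hz.trans hwP.2)) hw0
      have hfin : ENNReal.ofReal θ ^ n ≠ ∞ := ENNReal.pow_ne_top ENNReal.ofReal_ne_top
      have hadd' : ν G + min (P v) (P v') * ENNReal.ofReal θ ^ n ≤ ENNReal.ofReal θ ^ n :=
        (add_le_add le_rfl (mul_le_mul_left hwP.1 _)).trans hadd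
      calc ν G ≤ ENNReal.ofReal θ ^ n - min (P v) (P v') * ENNReal.ofReal θ ^ n :=
            ENNReal.le_sub_of_add_le_right
              (ne_top_of_le_ne_top hfin (le_add_self.trans hadd')) hadd'
        _ = (1 - min (P v) (P v')) * ENNReal.ofReal θ ^ n := by
            rw [ENNReal.sub_mul fun _ _ => hfin, one_mul]
        _ ≤ ENNReal.ofReal θ * ENNReal.ofReal θ ^ n := mul_le_mul_left hθle _
        _ = ENNReal.ofReal θ ^ (n + 1) := (pow_succ' _ _).symm
  have hsub : S.coding ⁻¹' J ⊆ {ω | S.coding (S.prependList [] ω) ∈ J ∧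
      volume J < ENNReal.ofReal (S.ratioProd φ γ (fun _ => δ)
        (([] : List A).length + v.length * k) (S.prependList [] ω))} ∪
      {ω | ENNReal.ofReal (S.ratioProd φ γ (fun _ => δ) (v.length * k) ω) ≤ volume J} := by
    intro ω hω
    rw [List.length_nil, zero_add]
    exact (lt_or_ge _ _).imp (fun h => ⟨hω, h⟩) id
  refine (measure_mono hsub).trans ((measure_union_le _ _).trans (add_le_add ?_ ?_))
  · rw [one_mul]
    exact claim k []
  · have h1 := hν.measure_ratioProd_le hφ hn ht hγ measurable_const (fun _ => hδ) (v.length * k)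
      (volume J)
    rw [lintegral_const, measure_univ, mul_one] at h1
    rwa [mul_comm (ENNReal.ofReal _), ← pow_mul]

end Bernoulli

/-! ### Choice of scale and conclusion. -/

/-- Balancing exponential decay in the scale against a power of the length. -/
lemma exists_rpow_bound {ι : Type*} {m V : ι → ℝ≥0∞} {K Z L : ℝ≥0∞} {θ γ : ℝ} (hγ : 0 < γ)
    (hK : K ≠ ∞) (hZ : Z ≠ ∞) (hL : L ≠ ∞) (hθ0 : 0 < θ) (hθ1 : θ < 1) (hm : ∀ i, m i ≤ 1)
    (h : ∀ i (k : ℕ), m i ≤ K * ENNReal.ofReal θ ^ k + Z * L ^ k * V i ^ γ) :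
    ∃ C s : ℝ, 1 ≤ C ∧ 0 < s ∧ s < 1 ∧ ∀ i, m i ≤ ENNReal.ofReal C * V i ^ s := by
  obtain ⟨ρ, hρ0, hρ1, hρ⟩ : ∃ ρ : ℝ, 0 < ρ ∧ ρ < 1 ∧
      L * ENNReal.ofReal ρ ^ γ ≤ ENNReal.ofReal θ := by
    have hlim : Tendsto (fun ρ : ℝ => L * ENNReal.ofReal ρ ^ γ) (𝓝[>] 0) (𝓝 0) := by
      have h1 : Tendsto (fun ρ : ℝ => ENNReal.ofReal ρ ^ γ) (𝓝[>] 0) (𝓝 0) := by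
        have h2 : Continuous fun ρ : ℝ => ENNReal.ofReal ρ ^ γ :=
          ENNReal.continuous_rpow_const.comp ENNReal.continuous_ofReal
        have h3 := (h2.tendsto 0).mono_left (nhdsWithin_le_nhds (s := Ioi 0))
        simpa [ENNReal.zero_rpow_of_pos hγ] using h3
      simpa using ENNReal.Tendsto.const_mul h1 (Or.inr hL)
    obtain ⟨ρ, h1, h2⟩ := ((hlim.eventually_le_const (ENNReal.ofReal_pos.2 hθ0)).and
      (Ioo_mem_nhdsGT one_pos)).exists
    exact ⟨ρ, h2.1, h2.2, h1⟩
  -- The exponent at which `ρ ^ s` equals `θ`, capped at `1/2` so that `s < 1`.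
  let s := min (Real.logb ρ θ) 2⁻¹
  have hs0 : 0 < s := lt_min (Real.logb_pos_of_base_lt_one hρ0 hρ1 hθ0 hθ1) (by norm_num)
  have hs1 : s < 1 := (min_le_right _ _).trans_lt (by norm_num)
  have hθs : θ ≤ ρ ^ s := by
    calc θ = ρ ^ Real.logb ρ θ := (Real.rpow_logb hρ0 hρ1.ne hθ0).symm
      _ ≤ ρ ^ s := Real.rpow_le_rpow_of_exponent_ge hρ0 hρ1.le (min_le_left _ _)
  have hKZ : K + Z ≠ ∞ := ENNReal.add_ne_top.2 ⟨hK, hZ⟩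
  have hscale : ∀ i (k : ℕ), V i ≤ ENNReal.ofReal (ρ ^ k) →
      m i ≤ (K + Z) * ENNReal.ofReal θ ^ k := by
    intro i k hk
    refine (h i k).trans ?_
    rw [add_mul]
    refine add_le_add le_rfl ?_
    rw [mul_assoc]
    refine mul_le_mul_right ?_ _
    calc L ^ k * V i ^ γ ≤ L ^ k * ENNReal.ofReal (ρ ^ k) ^ γ :=
          mul_le_mul_right (ENNReal.rpow_le_rpow hk hγ.le) _
      _ = (L * ENNReal.ofReal ρ ^ γ) ^ k := by
          rw [mul_pow, ENNReal.ofReal_pow hρ0.le, ← ENNReal.rpow_natCast, ← ENNReal.rpow_natCast,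
            ← ENNReal.rpow_natCast, ← ENNReal.rpow_mul, ← ENNReal.rpow_mul, mul_comm (k : ℝ)]
      _ ≤ ENNReal.ofReal θ ^ k := pow_le_pow_left' hρ k
  refine ⟨max 1 ((K + Z).toReal * (ρ ^ s)⁻¹), s, le_max_left _ _, hs0, hs1, fun i => ?_⟩
  rcases le_or_gt 1 (V i) with hV | hV
  · calc m i ≤ 1 * 1 := by rw [one_mul]; exact hm i
      _ ≤ _ := mul_le_mul' (by rw [ENNReal.one_le_ofReal]; exact le_max_left _ _)
          (ENNReal.one_le_rpow hV hs0)
  rcases eq_or_ne (V i) 0 with hV0 | hV0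
  · have hlim : Tendsto (fun k : ℕ => (K + Z) * ENNReal.ofReal θ ^ k) atTop (𝓝 0) := by
      have h1 := ENNReal.tendsto_pow_atTop_nhds_zero_of_lt_one (ENNReal.ofReal_lt_one.2 hθ1)
      simpa using ENNReal.Tendsto.const_mul h1 (Or.inr hKZ)
    -- For a null interval every scale is admissible, so `k` tends to infinity.
    have h0 : m i ≤ 0 := ge_of_tendsto' hlim fun k => hscale i k (by rw [hV0]; exact zero_le)
    exact h0.trans zero_le
  have hVt : V i ≠ ∞ := hV.ne_top
  set r := (V i).toReal with hr
  have hVr : V i = ENNReal.ofReal r := (ENNReal.ofReal_toReal hVt).symm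
  have hr0 : 0 < r := ENNReal.toReal_pos hV0 hVt
  have hr1 : r ≤ 1 := by
    simpa using (ENNReal.toReal_le_toReal hVt ENNReal.one_ne_top).2 hV.le
  -- Here `ρ ^ (k + 1) < r ≤ ρ ^ k`; the gap of one power is the factor `(ρ ^ s)⁻¹` in the constant.
  obtain ⟨k, hk1, hk2⟩ := exists_nat_pow_near_of_lt_one hr0 hr1 hρ0 hρ1
  refine (hscale i k (by rw [hVr]; exact ENNReal.ofReal_le_ofReal hk2)).trans ?_
  have hθk : θ ^ k ≤ (ρ ^ s)⁻¹ * r ^ s := by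
    have hρs : 0 < ρ ^ s := Real.rpow_pos_of_pos hρ0 s
    calc θ ^ k ≤ (ρ ^ s) ^ k := pow_le_pow_left₀ hθ0.le hθs k
      _ = (ρ ^ s)⁻¹ * (ρ ^ s) ^ (k + 1) := by rw [pow_succ']; field_simp
      _ = (ρ ^ s)⁻¹ * (ρ ^ (k + 1)) ^ s := by
          rw [← Real.rpow_natCast, ← Real.rpow_natCast, ← Real.rpow_mul hρ0.le,
            ← Real.rpow_mul hρ0.le, mul_comm s]
      _ ≤ (ρ ^ s)⁻¹ * r ^ s := mul_le_mul_of_nonneg_left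
          (Real.rpow_le_rpow (by positivity) hk1.le hs0.le) (inv_nonneg.2 hρs.le)
  calc (K + Z) * ENNReal.ofReal θ ^ k
      = ENNReal.ofReal (K + Z).toReal * ENNReal.ofReal (θ ^ k) := by
        rw [ENNReal.ofReal_toReal hKZ, ENNReal.ofReal_pow hθ0.le]
    _ = ENNReal.ofReal ((K + Z).toReal * θ ^ k) := (ENNReal.ofReal_mul ENNReal.toReal_nonneg).symm
    _ ≤ ENNReal.ofReal (max 1 ((K + Z).toReal * (ρ ^ s)⁻¹) * r ^ s) := by
        refine ENNReal.ofReal_le_ofReal ?_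
        calc _ ≤ (K + Z).toReal * ((ρ ^ s)⁻¹ * r ^ s) :=
              mul_le_mul_of_nonneg_left hθk ENNReal.toReal_nonneg
          _ = (K + Z).toReal * (ρ ^ s)⁻¹ * r ^ s := (mul_assoc _ _ _).symm
          _ ≤ _ := mul_le_mul_of_nonneg_right (le_max_right _ _) (Real.rpow_nonneg hr0.le s)
    _ = _ := by
        rw [ENNReal.ofReal_mul (zero_le_one.trans (le_max_left _ _)), hVr,
          ENNReal.ofReal_rpow_of_pos hr0]

end MarkovIFS

theorem mainTheorem8 {A : Type*} [Countable A] [TopologicalSpace A] [DiscreteTopology A]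
    [MeasurableSpace A] [DiscreteMeasurableSpace A]
    (S : MarkovIFS A) (φ : S.Shift → ℝ) (hvar : S.SummableVariations φ) (hnorm : S.Normalized φ)
    (γ₀ : ℝ) (hγ₀ : 0 < γ₀) (htail : S.LightTail φ γ₀)
    (ν : Measure S.Shift) (hν : S.IsGibbs φ ν)
    (hF : S.attractor.Nontrivial) (hcase : S.NoOverlaps ∨ S.IsBernoulli φ) :
    ∃ C s : ℝ, 1 ≤ C ∧ 0 < s ∧ s < 1 ∧ ∀ J : Set ℝ, J.OrdConnected →
      (ν.map S.coding) J ≤ ENNReal.ofReal C * volume J ^ s := by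
  have := hν.1
  have hφ := hvar.continuous
  obtain ⟨K, Z, L, hK, hZ, hL, θ, hθ0, hθ1, hmain⟩ := hcase.elim
    (fun hS => hS.exists_measure_le hν hφ hnorm htail hγ₀)
    (fun hB => hB.exists_measure_le hF hν hφ hnorm htail hγ₀)
  obtain ⟨C, s, hC, hs0, hs1, h⟩ := MarkovIFS.exists_rpow_bound
    (ι := {J : Set ℝ // J.OrdConnected}) (m := fun J => ν (S.coding ⁻¹' J.1))
    (V := fun J => volume J.1) hγ₀ hK hZ hL hθ0 hθ1 (fun _ => prob_le_one)
    (fun J k => hmain J.1 J.2 k)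
  refine ⟨C, s, hC, hs0, hs1, fun J hJ => ?_⟩
  rw [Measure.map_apply MarkovIFS.continuous_coding.measurable hJ.measurableSet]
  exact h ⟨J, hJ⟩
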